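/- Let $T>0$ and let $h:[0,T]\times\mathbb{R}^2\to\mathbb{R}$ be $C^2$. Put $\mathcal{D}_t=\{(x,y)\in\mathbb{R}^2\times\mathbb{R}: y\le h(t,x)\}$, let $n=(-\nabla h,1)/\sqrt{1+|\nabla h|^2}$ be the unit normal to $\partial\mathcal{D}_t$, and write $f|_{\partial\mathcal{D}_t}(x)=f(x,h(t,x))$. Let $v$, $p$ be $C^1$ up to the boundary ($v$ in space-time, $p(t,\cdot)$ in space for each $t$) and solve the free-boundary Euler equations with gravity, $$(\partial_t+v\cdot\partial)v=-\partial p-e_3,\quad \operatorname{div}v=0\ \text{ in }\mathcal{D}_t,\qquad \partial_t h+v^1\partial_1h+v^2\partial_2h=v^3,\quad p=0\ \text{ on }\partial\mathcal{D}_t,$$ for $0\le t\le T$. Let $\omega=\operatorname{curl}v$. For each $t\in[0,T]$ let $\psi(t,\cdot)\in L^6(\mathcal{D}_t)\cap\dot H^1(\mathcal{D}_t)$, $C^2$ up to the boundary, be the harmonic extension of the Neumann data $v\cdot n$: $\Delta\psi=0$ in $\mathcal{D}_t$ and $\nabla_n\psi=v\cdot n$ on $\partial\mathcal{D}_t$.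 Set $v_\omega=v-\partial\psi$, $\varphi=\psi|_{\partial\mathcal{D}_t}$, $V_\omega=(v_\omega^1,v_\omega^2)|_{\partial\mathcal{D}_t}$, $B_\omega=v_\omega^3|_{\partial\mathcal{D}_t}$ and $U_\omega=V_\omega+B_\omega\nabla h$. Let $G(h)F=\sqrt{1+|\nabla h|^2}\,\nabla_n f|_{\partial\mathcal{D}_t}$, where $f\in L^6\cap\dot H^1$ is the harmonic extension to $\mathcal{D}_t$, $C^2$ up to the boundary, of the Dirichlet data $F$. Then: 1. For each $t\in[0,T]$, $U_\omega(t,\cdot)$ is differentiable on $\mathbb{R}^2$ and $$\nabla_1U_\omega^2-\nabla_2U_\omega^1=\sqrt{1+|\nabla h|^2}\;\omega|_{\partial\mathcal{D}_t}\cdot n .$$ In particular, if $\omega\cdot n=0$ on $\partial\mathcal{D}_t$, then $U_\omega(t,\cdot)=\nabla a_\omega$ for a function $a_\omega:\mathbb{R}^2\to\mathbb{R}$. 2. On $[0,T]\times\mathbb{R}^2$, $\partial_th=G(h)\varphi$. If moreover $\omega\cdot n=0$ on $\partial\mathcal{D}_t$ for all $t\in[0,T]$, then, for any potentials $a_\omega(t,\cdot)$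 with $\nabla a_\omega=U_\omega$, after adding to $a_\omega$ a suitable function of $t$ alone, $\varphi+a_\omega$ is differentiable in $t$ and $$\partial_t(\varphi+a_\omega)=-h-\tfrac12|\nabla\varphi|^2+\tfrac12\frac{(G(h)\varphi+\nabla h\cdot\nabla\varphi)^2}{1+|\nabla h|^2}+R_\omega,$$ $$R_\omega=-\tfrac12|V_\omega|^2-\nabla\varphi\cdot V_\omega-\tfrac12(V_\omega\cdot\nabla h)^2+(G(h)\varphi)\,V_\omega\cdot\nabla h .$$ (Time derivatives at $t=0$ and $t=T$ are one-sided.) -/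

import Mathlib

open Set MeasureTheory Function
open scoped ContDiff Gradient

noncomputable section

namespace WaterWaves

/-- The horizontal plane `ℝ²`, with its Euclidean structure. -/
abbrev E2 := EuclideanSpace ℝ (Fin 2)

/-- Physical space `ℝ³`; the coordinate with index `2` is the vertical one. -/
abbrev E3 := EuclideanSpace ℝ (Fin 3)

/-! ### The fluid domain under a graph -/

/-- The horizontal part `(x₁, x₂)` of a point `(x₁, x₂, y)`. -/
def horizontal (z : E3) : E2 := !₂[z 0, z 1]

/-- The point `(x, η x)` of the free surface above `x`. -/
def surfacePoint (η : E2 → ℝ) (x : E2) : E3 := !₂[x 0, x 1, η x]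

/-- The fluid domain `{(x, y) | y ≤ η x}`. -/
def fluid (η : E2 → ℝ) : Set E3 := {z | z 2 ≤ η (horizontal z)}

/-- The space-time domain `{(t, z) | 0 ≤ t ≤ T, z ∈ D_t}`, with `D_t` the domain under `h t`. -/
def spaceTime (T : ℝ) (h : ℝ → E2 → ℝ) : Set (ℝ × E3) :=
  {q | q.1 ∈ Icc 0 T ∧ q.2 ∈ fluid (h q.1)}

/-- The outward unit normal `(-∇η, 1) / √(1 + |∇η|²)` at the surface point above `x`. -/
def unitNormal (η : E2 → ℝ) (x : E2) : E3 :=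
  (√(1 + ‖∇ η x‖ ^ 2))⁻¹ • !₂[-(∇ η x) 0, -(∇ η x) 1, 1]

/-! ### Derivatives

Functions on the (closed) fluid domain are differentiated within it, so that the derivatives make
sense up to the boundary; at interior points these are the ordinary derivatives. -/

/-- The partial derivative `∂_k u` of a vector field on the fluid domain under `η`, as a vector. -/
def partialD (η : E2 → ℝ) (k : Fin 3) (u : E3 → E3) (z : E3) : E3 :=
  fderivWithin ℝ u (fluid η) z (EuclideanSpace.single k 1)

/-- The gradient, up to the boundary, of a function on the fluid domain under `η`. -/
def gradD (η : E2 → ℝ) (f : E3 → ℝ) (z : E3) : E3 := gradientWithin f (fluid η) z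

/-- The divergence of a vector field on the fluid domain under `η`. -/
def divD (η : E2 → ℝ) (u : E3 → E3) (z : E3) : ℝ := ∑ k, partialD η k u z k

/-- The curl of a vector field on the fluid domain under `η`. -/
def curlD (η : E2 → ℝ) (u : E3 → E3) (z : E3) : E3 :=
  !₂[partialD η 1 u z 2 - partialD η 2 u z 1,
     partialD η 2 u z 0 - partialD η 0 u z 2,
     partialD η 0 u z 1 - partialD η 1 u z 0]

/-- The scalar curl `∂₁U² - ∂₂U¹` of a vector field on the plane. -/
def curl2 (U : E2 → E2) (x : E2) : ℝ :=
  fderiv ℝ U x (EuclideanSpace.single 0 1) 1 - fderiv ℝ U x (EuclideanSpace.single 1 1) 0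

/-- The time derivative `∂_t v` of a field on the space-time domain under `h`. -/
def timeD (T : ℝ) (h : ℝ → E2 → ℝ) (v : ℝ → E3 → E3) (t : ℝ) (z : E3) : E3 :=
  fderivWithin ℝ (uncurry v) (spaceTime T h) (t, z) (1, 0)

/-! ### The free-boundary Euler equations with gravity -/

/-- `(h, v, p)` is a classical solution, on the time interval `[0, T]`, of the incompressible Euler
equations with unit gravity under the free surface `y = h t x`, in vacuum and without surface
tension. -/
structure IsEulerFlow (T : ℝ) (h : ℝ → E2 → ℝ) (v : ℝ → E3 → E3) (p : ℝ → E3 → ℝ) : Prop where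
  contDiff_surface : ContDiffOn ℝ 2 (uncurry h) (Icc 0 T ×ˢ univ)
  contDiff_velocity : ContDiffOn ℝ 1 (uncurry v) (spaceTime T h)
  contDiff_pressure : ∀ t ∈ Icc 0 T, ContDiffOn ℝ 1 (p t) (fluid (h t))
  momentum : ∀ t ∈ Icc 0 T, ∀ z ∈ fluid (h t),
    timeD T h v t z + ∑ k, v t z k • partialD (h t) k (v t) z
      = -gradD (h t) (p t) z - EuclideanSpace.single 2 1
  incompressible : ∀ t ∈ Icc 0 T, ∀ z ∈ fluid (h t), divD (h t) (v t) z = 0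
  kinematic : ∀ t ∈ Icc 0 T, ∀ x : E2,
    derivWithin (fun s => h s x) (Icc 0 T) t
      + v t (surfacePoint (h t) x) 0 * (∇ (h t) x) 0
      + v t (surfacePoint (h t) x) 1 * (∇ (h t) x) 1
      = v t (surfacePoint (h t) x) 2
  vacuum : ∀ t ∈ Icc 0 T, ∀ x : E2, p t (surfacePoint (h t) x) = 0

/-! ### Harmonic functions on the fluid domain and the Dirichlet-to-Neumann operator -/

/-- `f` is harmonic in the domain under `η`, is `C²` up to the boundary, and lies in
`L⁶ ∩ Ḣ¹`. -/
structure IsHarmonicUnder (η : E2 → ℝ) (f : E3 → ℝ) : Prop where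
  contDiff : ContDiffOn ℝ 2 f (fluid η)
  harmonic : InnerProductSpace.HarmonicOnNhd f (interior (fluid η))
  memLp : MemLp f 6 (volume.restrict (fluid η))
  memLp_grad : MemLp (gradD η f) 2 (volume.restrict (fluid η))

/-- The trace of a function on the free surface, as a function on the plane. -/
def trace {F : Type*} (η : E2 → ℝ) (f : E3 → F) (x : E2) : F := f (surfacePoint η x)

/-- The normal derivative `∇_n f` on the free surface, as a function on the plane. -/
def normalD (η : E2 → ℝ) (f : E3 → ℝ) (x : E2) : ℝ :=
  inner ℝ (unitNormal η x) (trace η (gradD η f) x)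

/-- `f` is the harmonic extension to the domain under `η` of the Neumann data `u · n`. -/
def IsNeumannExtension (η : E2 → ℝ) (u : E3 → E3) (f : E3 → ℝ) : Prop :=
  IsHarmonicUnder η f ∧ ∀ x, normalD η f x = inner ℝ (unitNormal η x) (trace η u x)

/-- `f` is the harmonic extension to the domain under `η` of the Dirichlet data `F`. -/
def IsDirichletExtension (η : E2 → ℝ) (F : E2 → ℝ) (f : E3 → ℝ) : Prop :=
  IsHarmonicUnder η f ∧ trace η f = F

open Classical in
/-- The rescaled Dirichlet-to-Neumann operator: `G(η) F = √(1 + |∇η|²) ∇_n f`, with `f` the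
harmonic extension of `F` (and the value `0` if `F` has no such extension). -/
def dirichletNeumann (η : E2 → ℝ) (F : E2 → ℝ) (x : E2) : ℝ :=
  if H : ∃ f, IsDirichletExtension η F f then
    √(1 + ‖∇ η x‖ ^ 2) * normalD η H.choose x
  else 0

/-! ### The boundary variables -/

/-- The rotational part `v_ω = u - ∇ψ` of a velocity field `u`. -/
def rotational (η : E2 → ℝ) (u : E3 → E3) (ψ : E3 → ℝ) (z : E3) : E3 := u z - gradD η ψ z

/-- `V_ω`, the horizontal part of the trace of the rotational part. -/
def Vω (η : E2 → ℝ) (u : E3 → E3) (ψ : E3 → ℝ) (x : E2) : E2 :=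
  horizontal (trace η (rotational η u ψ) x)

/-- `B_ω`, the vertical part of the trace of the rotational part. -/
def Bω (η : E2 → ℝ) (u : E3 → E3) (ψ : E3 → ℝ) (x : E2) : ℝ :=
  trace η (rotational η u ψ) x 2

/-- `U_ω = V_ω + B_ω ∇η`. -/
def Uω (η : E2 → ℝ) (u : E3 → E3) (ψ : E3 → ℝ) (x : E2) : E2 :=
  Vω η u ψ x + Bω η u ψ x • ∇ η x

/-- The component `ω · n` of the vorticity `ω = curl u` normal to the free surface. -/
def normalVorticity (η : E2 → ℝ) (u : E3 → E3) (x : E2) : ℝ :=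
  inner ℝ (trace η (curlD η u) x) (unitNormal η x)

/-- The right-hand side of the irrotational (Zakharov / Craig–Sulem) equation for the potential
`F` at the free surface:
`-η - |∇F|² / 2 + (G(η)F + ∇η · ∇F)² / (2 (1 + |∇η|²))`. -/
def zakharovRHS (η : E2 → ℝ) (F : E2 → ℝ) (x : E2) : ℝ :=
  -η x - 1 / 2 * ‖∇ F x‖ ^ 2
    + 1 / 2 * ((dirichletNeumann η F x + inner ℝ (∇ η x) (∇ F x)) ^ 2 / (1 + ‖∇ η x‖ ^ 2))

/-- The vortical term
`R_ω = -|W|² / 2 - ∇F · W - (W · ∇η)² / 2 + (G(η)F) (W · ∇η)`, to be used with `W = V_ω`. -/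
def Rω (η : E2 → ℝ) (F : E2 → ℝ) (W : E2 → E2) (x : E2) : ℝ :=
  -(1 / 2) * ‖W x‖ ^ 2 - inner ℝ (∇ F x) (W x) - 1 / 2 * (inner ℝ (W x) (∇ η x)) ^ 2
    + dirichletNeumann η F x * inner ℝ (W x) (∇ η x)

end WaterWaves

end

open WaterWaves

/-! Regard a velocity field `u` as a one-form and pull it back to the plane by the graph map; the
result is `u_h + u₃ ∇η`, called `tangentialTrace`. Pullback commutes with the exterior derivative.
So gradients pull back to gradients of traces, and the planar curl of the pullback is the vorticity
paired with the unnormalised normal. Since `v = ∂ψ + v_ω`, the pullback of `v` is `∇φ + U_ω`, and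
`U_ω` has the same curl as the pullback of `v`. This gives the curl formula, and the Poincaré lemma
gives the potential.

The kinematic condition says that `∂_t h` is `√(1 + |∇h|²) v · n`, which is the rescaled normal
derivative of `ψ`. Calling this `G(h)φ` requires the Dirichlet extension to be unique
(`IsDirichletExtension.eqOn`), because `dirichletNeumann` picks an arbitrary one. Uniqueness is an
energy argument with a truncation and cutoffs; membership in `L⁶ ∩ Ḣ¹` makes the cutoff error vanish
at infinity.

No regularity of `ψ` or of the potentials in time is assumed, so `φ + a_ω` cannot be differentiated
directly. Instead, when `ω · n = 0`, the one-form on `[0, T] × ℝ²` whose spatial part is the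
pullback of `v` and whose `dt` coefficient is `bernoulli` is closed, by Euler's equations on the
surface, the kinematic condition and `p = 0` (`IsEulerFlow.exists_potential`). Its primitive `f` has
the same spatial gradient as `φ + a_ω`, so the two differ by a function of time, which is absorbed
into `a_ω`. An algebraic identity (`zakharovRHS_add_Rω`) rewrites `bernoulli` in the stated form. -/

namespace WaterWaves

/-! ### Gradients in coordinates -/

/-- The vector in `ℝⁿ` with the components of a covector. -/
noncomputable def sharp (n : ℕ) :
    (EuclideanSpace ℝ (Fin n) →L[ℝ] ℝ) →L[ℝ] EuclideanSpace ℝ (Fin n) :=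
  ((EuclideanSpace.equiv (Fin n) ℝ).symm : (Fin n → ℝ) →L[ℝ] EuclideanSpace ℝ (Fin n)) ∘L
    ContinuousLinearMap.pi fun i => ContinuousLinearMap.apply ℝ ℝ (EuclideanSpace.single i 1)

@[simp] theorem sharp_apply {n : ℕ} (l : EuclideanSpace ℝ (Fin n) →L[ℝ] ℝ) (i : Fin n) :
    sharp n l i = l (EuclideanSpace.single i 1) := rfl

theorem gradientWithin_apply {n : ℕ} (f : EuclideanSpace ℝ (Fin n) → ℝ)
    (s : Set (EuclideanSpace ℝ (Fin n))) (z : EuclideanSpace ℝ (Fin n)) (i : Fin n) :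
    gradientWithin f s z i = fderivWithin ℝ f s z (EuclideanSpace.single i 1) := by
  rw [← inner_gradientWithin_left, EuclideanSpace.inner_single_right]
  simp

theorem gradient_apply {n : ℕ} (f : EuclideanSpace ℝ (Fin n) → ℝ)
    (z : EuclideanSpace ℝ (Fin n)) (i : Fin n) :
    (∇ f z) i = fderiv ℝ f z (EuclideanSpace.single i 1) := by
  rw [← gradientWithin_univ, gradientWithin_apply, fderivWithin_univ]

theorem gradientWithin_eq_sharp {n : ℕ} (f : EuclideanSpace ℝ (Fin n) → ℝ)
    (s : Set (EuclideanSpace ℝ (Fin n))) (z : EuclideanSpace ℝ (Fin n)) :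
    gradientWithin f s z = sharp n (fderivWithin ℝ f s z) := by
  ext i; rw [gradientWithin_apply, sharp_apply]

theorem gradient_eq_sharp {n : ℕ} (f : EuclideanSpace ℝ (Fin n) → ℝ)
    (z : EuclideanSpace ℝ (Fin n)) : ∇ f z = sharp n (fderiv ℝ f z) := by
  ext i; rw [gradient_apply, sharp_apply]

theorem hasGradientAt_of_hasFDerivAt {n : ℕ} {f : EuclideanSpace ℝ (Fin n) → ℝ}
    {l : EuclideanSpace ℝ (Fin n) →L[ℝ] ℝ} {g x : EuclideanSpace ℝ (Fin n)}
    (h : HasFDerivAt f l x) (hg : ∀ i, l (EuclideanSpace.single i 1) = g i) :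
    HasGradientAt f g x := by
  convert! h.differentiableAt.hasGradientAt using 1
  ext i
  rw [gradient_apply, h.fderiv, hg]

/-- A linear map out of `ℝ²` in terms of its values on the standard basis. -/
theorem map_E2 {F : Type*} [NormedAddCommGroup F] [NormedSpace ℝ F] (L : E2 →L[ℝ] F) (a : E2) :
    L a = a 0 • L (EuclideanSpace.single 0 1) + a 1 • L (EuclideanSpace.single 1 1) := by
  rw [← map_smul, ← map_smul, ← map_add]
  congr 1
  ext i; fin_cases i <;> simp

theorem map_E3 {F : Type*} [NormedAddCommGroup F] [NormedSpace ℝ F] (L : E3 →L[ℝ] F) (a : E3) :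
    L a = a 0 • L (EuclideanSpace.single 0 1) + a 1 • L (EuclideanSpace.single 1 1)
      + a 2 • L (EuclideanSpace.single 2 1) := by
  rw [← map_smul, ← map_smul, ← map_smul, ← map_add, ← map_add]
  congr 1
  ext i; fin_cases i <;> simp

/-! ### The fluid domain -/

/-- `horizontal` as a continuous linear map. -/
noncomputable def horizontalL : E3 →L[ℝ] E2 :=
  ((EuclideanSpace.equiv (Fin 2) ℝ).symm : (Fin 2 → ℝ) →L[ℝ] E2) ∘L
    ContinuousLinearMap.pi ![EuclideanSpace.proj 0, EuclideanSpace.proj 1]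

@[simp] theorem horizontalL_apply (z : E3) : horizontalL z = horizontal z := by
  ext i; fin_cases i <;> rfl

/-- The embedding of the plane as `{z | z 2 = 0}`. -/
noncomputable def liftL : E2 →L[ℝ] E3 :=
  ((EuclideanSpace.equiv (Fin 3) ℝ).symm : (Fin 3 → ℝ) →L[ℝ] E3) ∘L
    ContinuousLinearMap.pi ![EuclideanSpace.proj 0, EuclideanSpace.proj 1, 0]

@[simp] theorem horizontal_zero_apply (z : E3) : horizontal z 0 = z 0 := rfl
@[simp] theorem horizontal_one_apply (z : E3) : horizontal z 1 = z 1 := rfl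
@[simp] theorem liftL_zero_apply (x : E2) : liftL x 0 = x 0 := rfl
@[simp] theorem liftL_one_apply (x : E2) : liftL x 1 = x 1 := rfl
@[simp] theorem liftL_two_apply (x : E2) : liftL x 2 = 0 := rfl
@[simp] theorem surfacePoint_zero_apply (η : E2 → ℝ) (x : E2) : surfacePoint η x 0 = x 0 := rfl
@[simp] theorem surfacePoint_one_apply (η : E2 → ℝ) (x : E2) : surfacePoint η x 1 = x 1 := rfl
@[simp] theorem surfacePoint_two_apply (η : E2 → ℝ) (x : E2) : surfacePoint η x 2 = η x := rfl

@[simp] theorem horizontal_surfacePoint (η : E2 → ℝ) (x : E2) :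
    horizontal (surfacePoint η x) = x := by
  ext i; fin_cases i <;> rfl

theorem mem_fluid {η : E2 → ℝ} {z : E3} : z ∈ fluid η ↔ z 2 ≤ η (horizontal z) := by
  rw [fluid, mem_ofPred_eq]

theorem surfacePoint_mem_fluid (η : E2 → ℝ) (x : E2) : surfacePoint η x ∈ fluid η := by
  simp [fluid]

theorem surfacePoint_eq (η : E2 → ℝ) (x : E2) :
    surfacePoint η x = liftL x + η x • EuclideanSpace.single 2 1 := by
  ext i; fin_cases i <;> simp

theorem hasFDerivAt_surfacePoint {η : E2 → ℝ} {x : E2} {η' : E2 →L[ℝ] ℝ}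
    (h : HasFDerivAt η η' x) :
    HasFDerivAt (surfacePoint η) (liftL + η'.smulRight (EuclideanSpace.single 2 1)) x := by
  rw [show surfacePoint η = fun x => liftL x + η x • EuclideanSpace.single 2 1 from
    funext (surfacePoint_eq η)]
  exact liftL.hasFDerivAt.add (h.smul_const _)

theorem convex_halfSpace : Convex ℝ {z : E3 | z 2 ≤ 0} := by
  intro z hz w hw a b ha hb _
  simp only [mem_ofPred_eq, PiLp.add_apply, PiLp.smul_apply, smul_eq_mul] at *
  nlinarith

theorem interior_halfSpace_nonempty : (interior {z : E3 | z 2 ≤ 0}).Nonempty := by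
  refine ⟨EuclideanSpace.single 2 (-1), mem_interior.2 ⟨{z : E3 | z 2 < 0}, ?_, ?_, by simp⟩⟩
  · exact fun z (hz : z 2 < 0) => mem_ofPred_eq ▸ hz.le
  · exact isOpen_lt (by fun_prop) continuous_const

theorem fluid_eq_image (η : E2 → ℝ) :
    fluid η = (fun z : E3 => z + η (horizontal z) • EuclideanSpace.single 2 1) ''
      {z : E3 | z 2 ≤ 0} := by
  ext z
  have key : ∀ (w : E3) (c : ℝ), horizontal (w + c • EuclideanSpace.single 2 1) = horizontal w := by
    intro w c; ext i; fin_cases i <;> simp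
  simp only [fluid, mem_ofPred_eq, mem_image]
  constructor
  · intro hz
    refine ⟨z + (-η (horizontal z)) • EuclideanSpace.single 2 1, by simpa using hz, ?_⟩
    rw [key]; ext i; simp
  · rintro ⟨w, hw, rfl⟩
    rw [key]; simpa using hw

/-- The fluid is the image of a half-space under a vertical shear whose derivative is invertible,
and unique differentiability passes to such images. Derivatives within the fluid are therefore well
determined on the surface too. -/
theorem uniqueDiffOn_fluid {η : E2 → ℝ} (hη : Differentiable ℝ η) : UniqueDiffOn ℝ (fluid η) := by
  rw [fluid_eq_image]
  refine (uniqueDiffOn_convex convex_halfSpace interior_halfSpace_nonempty).image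
    (f' := fun z => ContinuousLinearMap.id ℝ E3 +
      ((fderiv ℝ η (horizontal z)).comp horizontalL).smulRight (EuclideanSpace.single 2 1)) ?_ ?_
  · intro z _
    refine ((hasFDerivAt_id z).add (HasFDerivAt.smul_const ?_ _)).hasFDerivWithinAt
    have := (hη (horizontal z)).hasFDerivAt
    simp only [← horizontalL_apply] at this ⊢
    exact this.comp z horizontalL.hasFDerivAt
  · intro z _
    refine Surjective.denseRange fun w => ?_
    refine ⟨w - (fderiv ℝ η (horizontal z) (horizontal w)) • EuclideanSpace.single 2 1, ?_⟩
    have : horizontal (w - (fderiv ℝ η (horizontal z) (horizontal w)) •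
        EuclideanSpace.single 2 1) = horizontal w := by
      ext i; fin_cases i <;> simp
    simp [this]

/-- Moving straight down from any point enters the interior. This is what symmetry of second
derivatives within the fluid requires at surface points. -/
theorem mem_closure_interior_fluid {η : E2 → ℝ} (hη : Continuous η) {z : E3} (hz : z ∈ fluid η) :
    z ∈ closure (interior (fluid η)) := by
  have hopen : {w : E3 | w 2 < η (horizontal w)} ⊆ interior (fluid η) := by
    refine interior_maximal (fun w (hw : w 2 < _) => mem_fluid.2 hw.le) (isOpen_lt (by fun_prop) ?_)
    simp_rw [← horizontalL_apply]; fun_prop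
  refine closure_mono hopen (mem_closure_of_tendsto
    (f := fun ε : ℝ => z - ε • EuclideanSpace.single 2 1) (b := nhdsWithin 0 (Ioi 0)) ?_ ?_)
  · refine (Continuous.tendsto' (by fun_prop) _ _ (by simp)).mono_left nhdsWithin_le_nhds
  · filter_upwards [self_mem_nhdsWithin] with ε hε
    have : horizontal (z - ε • EuclideanSpace.single 2 1) = horizontal z := by
      ext i; fin_cases i <;> simp
    have hz' := mem_fluid.1 hz
    have : (0 : ℝ) < ε := hε
    simp_all; linarith

/-! ### Tangential traces -/

/-- `u_h + u₃ ∇η` on the surface: the tangential trace of `u` pulled back to the plane. -/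
noncomputable def tangentialTrace (η : E2 → ℝ) (u : E3 → E3) (x : E2) : E2 :=
  horizontal (u (surfacePoint η x)) + u (surfacePoint η x) 2 • ∇ η x

theorem Uω_eq_tangentialTrace (η : E2 → ℝ) (u : E3 → E3) (ψ : E3 → ℝ) :
    Uω η u ψ = tangentialTrace η (rotational η u ψ) := rfl

/-- The graph map never leaves the fluid, so a one-sided derivative there composes to a full
derivative on the plane. -/
theorem hasFDerivAt_trace {F : Type*} [NormedAddCommGroup F] [NormedSpace ℝ F] {η : E2 → ℝ}
    (hη : Differentiable ℝ η) {u : E3 → F} {x : E2}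
    (hu : DifferentiableWithinAt ℝ u (fluid η) (surfacePoint η x)) :
    HasFDerivAt (trace η u) ((fderivWithin ℝ u (fluid η) (surfacePoint η x)).comp
      (liftL + (fderiv ℝ η x).smulRight (EuclideanSpace.single 2 1))) x := by
  have h1 := hasFDerivAt_surfacePoint (hη x).hasFDerivAt
  rw [← hasFDerivWithinAt_univ] at h1 ⊢
  exact hu.hasFDerivWithinAt.comp x h1 fun y _ => surfacePoint_mem_fluid η y

theorem surface_tangent (η : E2 → ℝ) (x : E2) (i : Fin 2) :
    (liftL + (fderiv ℝ η x).smulRight (EuclideanSpace.single 2 1 : E3))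
      (EuclideanSpace.single i 1) =
      EuclideanSpace.single i.castSucc 1 + (∇ η x) i • EuclideanSpace.single 2 1 := by
  rw [gradient_apply]
  ext j
  fin_cases i <;> fin_cases j <;> simp

theorem hasGradientAt_trace {η : E2 → ℝ} (hη : Differentiable ℝ η) {f : E3 → ℝ} {x : E2}
    (hf : DifferentiableWithinAt ℝ f (fluid η) (surfacePoint η x)) :
    HasGradientAt (trace η f) (tangentialTrace η (gradD η f) x) x := by
  refine hasGradientAt_of_hasFDerivAt (hasFDerivAt_trace hη hf) fun i => ?_
  rw [ContinuousLinearMap.comp_apply, surface_tangent]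
  simp only [map_add, map_smul, tangentialTrace, PiLp.add_apply, PiLp.smul_apply, smul_eq_mul,
    gradD, gradientWithin_apply]
  fin_cases i <;> simp [gradientWithin_apply, mul_comm]

theorem differentiable_gradient {η : E2 → ℝ} (hη : ContDiff ℝ 2 η) : Differentiable ℝ (∇ η) := by
  have : ∇ η = fun x => sharp 2 (fderiv ℝ η x) := funext (gradient_eq_sharp η)
  rw [this]
  have := (hη.fderiv_right (m := 1) (by norm_num)).differentiable (by norm_num)
  fun_prop

theorem fderiv_gradient_symm {η : E2 → ℝ} (hη : ContDiff ℝ 2 η) (x : E2) (i j : Fin 2) :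
    fderiv ℝ (∇ η) x (EuclideanSpace.single i 1) j =
      fderiv ℝ (∇ η) x (EuclideanSpace.single j 1) i := by
  have h1 : ∇ η = fun x => sharp 2 (fderiv ℝ η x) := funext (gradient_eq_sharp η)
  have h2 := (hη.fderiv_right (m := 1) (by norm_num)).differentiable (by norm_num) x
  have h3 : HasFDerivAt (∇ η) ((sharp 2).comp (fderiv ℝ (fderiv ℝ η) x)) x := by
    rw [h1]; exact (sharp 2).hasFDerivAt.comp x h2.hasFDerivAt
  rw [h3.fderiv]
  simp only [ContinuousLinearMap.comp_apply, sharp_apply]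
  exact (hη.contDiffAt.isSymmSndFDerivAt (by simp)).eq _ _

theorem hasFDerivAt_tangentialTrace {η : E2 → ℝ} (hη : ContDiff ℝ 2 η) {u : E3 → E3} {x : E2}
    (hu : DifferentiableWithinAt ℝ u (fluid η) (surfacePoint η x)) :
    HasFDerivAt (tangentialTrace η u)
      (horizontalL.comp (fderiv ℝ (trace η u) x) +
        (u (surfacePoint η x) 2 • fderiv ℝ (∇ η) x +
          ((EuclideanSpace.proj 2 : E3 →L[ℝ] ℝ).comp (fderiv ℝ (trace η u) x)).smulRight
            (∇ η x))) x := by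
  have h1 := (hasFDerivAt_trace (hη.differentiable (by norm_num)) hu).differentiableAt.hasFDerivAt
  have h2 := (differentiable_gradient hη x).hasFDerivAt
  have h3 := horizontalL.hasFDerivAt.comp x h1
  have h4 := (EuclideanSpace.proj 2 : E3 →L[ℝ] ℝ).hasFDerivAt.comp x h1
  refine (h3.add (h4.smul h2)).congr_of_eventuallyEq (Filter.Eventually.of_forall fun y => ?_)
  simp [tangentialTrace, trace]

theorem sqrt_smul_unitNormal (η : E2 → ℝ) (x : E2) :
    √(1 + ‖∇ η x‖ ^ 2) • unitNormal η x = !₂[-(∇ η x) 0, -(∇ η x) 1, 1] := by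
  rw [unitNormal, smul_smul, mul_inv_cancel₀ (by positivity), one_smul]

theorem sqrt_mul_inner_unitNormal (η : E2 → ℝ) (x : E2) (w : E3) :
    √(1 + ‖∇ η x‖ ^ 2) * inner ℝ (unitNormal η x) w =
      w 2 - (∇ η x) 0 * w 0 - (∇ η x) 1 * w 1 := by
  rw [← real_inner_smul_left, sqrt_smul_unitNormal]
  simp [PiLp.inner_apply, Fin.sum_univ_three]
  ring

/-- Exterior differentiation commutes with pullback. Concretely, the second derivatives of `η`
cancel by symmetry, as do the products of both components of `∇η`; what remains is the curl against
`(-∇η, 1)`. -/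
theorem curl2_tangentialTrace {η : E2 → ℝ} (hη : ContDiff ℝ 2 η) {u : E3 → E3} {x : E2}
    (hu : DifferentiableWithinAt ℝ u (fluid η) (surfacePoint η x)) :
    curl2 (tangentialTrace η u) x = √(1 + ‖∇ η x‖ ^ 2) * normalVorticity η u x := by
  rw [normalVorticity, real_inner_comm, sqrt_mul_inner_unitNormal, curl2,
    (hasFDerivAt_tangentialTrace hη hu).fderiv,
    (hasFDerivAt_trace (hη.differentiable (by norm_num)) hu).fderiv]
  have hs := fderiv_gradient_symm hη x 0 1
  simp only [_root_.add_apply, ContinuousLinearMap.comp_apply,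
    _root_.smul_apply, ContinuousLinearMap.smulRight_apply, PiLp.add_apply,
    PiLp.smul_apply, smul_eq_mul, hs]
  have h0 := surface_tangent η x 0
  have h1 := surface_tangent η x 1
  simp only [_root_.add_apply, ContinuousLinearMap.smulRight_apply] at h0 h1
  rw [h0, h1]
  simp [trace, curlD, partialD]
  ring

/-! ### Curl of gradients up to the boundary, and the Poincaré lemma in the plane -/

theorem contDiffOn_gradD {η : E2 → ℝ} (hη : Differentiable ℝ η) {f : E3 → ℝ}
    (hf : ContDiffOn ℝ 2 f (fluid η)) : ContDiffOn ℝ 1 (gradD η f) (fluid η) := by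
  have : gradD η f = fun z => sharp 3 (fderivWithin ℝ f (fluid η) z) :=
    funext (gradientWithin_eq_sharp f _)
  rw [this]
  exact (sharp 3).contDiff.comp_contDiffOn (hf.fderivWithin (uniqueDiffOn_fluid hη) (by norm_num))

theorem partialD_gradD_symm {η : E2 → ℝ} (hη : Differentiable ℝ η) {f : E3 → ℝ}
    (hf : ContDiffOn ℝ 2 f (fluid η)) {z : E3} (hz : z ∈ fluid η) (i j : Fin 3) :
    partialD η i (gradD η f) z j = partialD η j (gradD η f) z i := by
  have h1 : gradD η f = fun z => sharp 3 (fderivWithin ℝ f (fluid η) z) :=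
    funext (gradientWithin_eq_sharp f _)
  have hU := uniqueDiffOn_fluid hη
  have h2 := (hf.fderivWithin hU (m := 1) (by norm_num)).differentiableOn (by norm_num) z hz
  have h3 : HasFDerivWithinAt (gradD η f)
      ((sharp 3).comp (fderivWithin ℝ (fderivWithin ℝ f (fluid η)) (fluid η) z)) (fluid η) z := by
    rw [h1]; exact (sharp 3).hasFDerivAt.comp_hasFDerivWithinAt z h2.hasFDerivWithinAt
  simp only [partialD, h3.fderivWithin (hU z hz), ContinuousLinearMap.comp_apply, sharp_apply]
  exact ((hf z hz).isSymmSndFDerivWithinAt (by simp) hU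
    (mem_closure_interior_fluid hη.continuous hz) hz).eq _ _

theorem curlD_gradD {η : E2 → ℝ} (hη : Differentiable ℝ η) {f : E3 → ℝ}
    (hf : ContDiffOn ℝ 2 f (fluid η)) {z : E3} (hz : z ∈ fluid η) : curlD η (gradD η f) z = 0 := by
  ext i
  fin_cases i <;> simp [curlD, partialD_gradD_symm hη hf hz]

theorem curlD_rotational {η : E2 → ℝ} (hη : Differentiable ℝ η) {f : E3 → ℝ} {u : E3 → E3}
    (hu : DifferentiableOn ℝ u (fluid η)) (hf : ContDiffOn ℝ 2 f (fluid η)) {z : E3}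
    (hz : z ∈ fluid η) : curlD η (rotational η u f) z = curlD η u z := by
  have hU := uniqueDiffOn_fluid hη z hz
  have h1 : ∀ k, partialD η k (rotational η u f) z =
      partialD η k u z - partialD η k (gradD η f) z := by
    intro k
    have := fderivWithin_sub hU (hu z hz)
      (((contDiffOn_gradD hη hf).differentiableOn (by norm_num)) z hz)
    simp only [partialD]
    rw [← _root_.sub_apply, ← this]
    rfl
  have h2 : curlD η (rotational η u f) z = curlD η u z - curlD η (gradD η f) z := by
    ext i
    fin_cases i <;> simp [curlD, h1] <;> ring
  rw [h2, curlD_gradD hη hf hz, sub_zero]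

theorem exists_hasGradientAt_of_curl2_eq_zero {U : E2 → E2} (hU : Differentiable ℝ U)
    (hc : ∀ x, curl2 U x = 0) : ∃ α : E2 → ℝ, ∀ x, HasGradientAt α (U x) x := by
  have hd : DifferentiableOn ℝ (fun x => innerSL ℝ (U x)) univ :=
    ((innerSL ℝ).differentiable.comp hU).differentiableOn
  have hcl : ∀ x ∈ (univ : Set E2), ∀ a b, fderiv ℝ (fun x => innerSL ℝ (U x)) x a b =
      fderiv ℝ (fun x => innerSL ℝ (U x)) x b a := by
    intro x _ a b
    have h1 : HasFDerivAt (fun x => innerSL ℝ (U x)) ((innerSL ℝ).comp (fderiv ℝ U x)) x :=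
      (innerSL ℝ).hasFDerivAt.comp x (hU x).hasFDerivAt
    have h2 := hc x
    rw [curl2] at h2
    rw [h1.fderiv, ContinuousLinearMap.comp_apply, ContinuousLinearMap.comp_apply, map_E2 (fderiv ℝ U x) a,
      map_E2 (fderiv ℝ U x) b]
    simp only [innerSL_apply_apply, PiLp.inner_apply, Fin.sum_univ_two, PiLp.add_apply,
      PiLp.smul_apply, smul_eq_mul]
    simp
    linear_combination (a 0 * b 1 - a 1 * b 0) * h2
  obtain ⟨α, hα⟩ := convex_univ.exists_forall_hasFDerivAt_of_fderiv_symmetric isOpen_univ hd hcl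
  refine ⟨α, fun x => hasGradientAt_of_hasFDerivAt (hα x (mem_univ x)) fun i => ?_⟩
  simp [EuclideanSpace.inner_single_right]

/-! ### Harmonic functions vanishing on the boundary -/

/-- Take `θ(s) = s σ(s)` with `σ` a smooth step from 0 to 1 starting at `ε`. Composed with a
function vanishing on the boundary, `θ` gives a test function supported away from it, and `|θ(s)| ≤
|s|` keeps the `L⁶` bound. -/
theorem exists_smooth_truncation {ε : ℝ} (hε : 0 < ε) :
    ∃ θ : ℝ → ℝ, ContDiff ℝ 1 θ ∧ (∀ s ≤ ε, θ s = 0) ∧ (∀ s, 0 ≤ deriv θ s) ∧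
      (∀ s, ε < s → 0 < deriv θ s) ∧ ∀ s, |θ s| ≤ |s| := by
  set σ : ℝ → ℝ := fun s => Real.smoothTransition (s / ε - 1) with hσ
  have hσ0 : ∀ s ≤ ε, σ s = 0 := fun s hs =>
    Real.smoothTransition.zero_of_nonpos (by rw [sub_nonpos, div_le_one hε]; exact hs)
  have hσm : Monotone σ := fun a b hab => Real.smoothTransition.monotone (by gcongr)
  have hσc : ContDiff ℝ 1 σ :=
    (Real.smoothTransition.contDiff (n := 1)).comp ((contDiff_id.div_const ε).sub contDiff_const)
  have hn : ∀ s, 0 ≤ σ s := fun s => Real.smoothTransition.nonneg _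
  have hmono : Monotone fun s => s * σ s := by
    intro a b hab
    rcases le_total b ε with hb | hb
    · simp [hσ0 b hb, hσ0 a (hab.trans hb)]
    rcases le_total a ε with ha | ha
    · simpa [hσ0 a ha] using mul_nonneg (hε.le.trans hb) (hn b)
    · exact mul_le_mul hab (hσm hab) (hn a) (hε.le.trans hb)
  refine ⟨fun s => s * σ s, contDiff_id.mul hσc, fun s hs => by simp [hσ0 s hs],
    fun s => hmono.deriv_nonneg, fun s hs => ?_, fun s => ?_⟩
  · have h1 := (hσc.differentiable (by norm_num) s).hasDerivAt
    rw [((hasDerivAt_id' s).fun_mul h1).deriv]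
    have h2 : 0 < σ s := Real.smoothTransition.pos_of_pos (by rw [sub_pos, one_lt_div hε]; exact hs)
    have h3 : 0 ≤ deriv σ s := hσm.deriv_nonneg
    have h4 : 0 < s := hε.trans hs
    positivity
  · rw [abs_mul, abs_of_nonneg (hn s)]
    exact mul_le_of_le_one_right (abs_nonneg s) (Real.smoothTransition.le_one _)

section Energy

variable {Ω : Set E3} {F : E3 → ℝ}

theorem continuous_of_zero_below (hΩ : IsOpen Ω) (hF : Continuous F) (h0 : ∀ z ∉ Ω, F z = 0)
    {ε : ℝ} (hε : 0 < ε) {X : Type*} [TopologicalSpace X] [Zero X] {g : E3 → X}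
    (hg : ContinuousOn g Ω) (hg0 : ∀ z, F z < ε → g z = 0) : Continuous g := by
  refine continuous_iff_continuousAt.2 fun z => ?_
  by_cases hz : z ∈ Ω
  · exact hg.continuousAt (hΩ.mem_nhds hz)
  · have : g =ᶠ[nhds z] fun _ => 0 := by
      filter_upwards [hF.continuousAt.eventually_lt_const (by rw [h0 z hz]; exact hε)] with w hw
      exact hg0 w hw
    exact continuousAt_const.congr this.symm

/-- Test `ΔF = 0` against `χ θ(F)` and integrate by parts in each coordinate. The test function has
compact support inside `Ω`, so no regularity of the boundary and no boundary term enters. -/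
theorem integral_cutoff_truncation (hΩ : IsOpen Ω) (hF : Continuous F) (h0 : ∀ z ∉ Ω, F z = 0)
    (hh : InnerProductSpace.HarmonicOnNhd F Ω) {ε : ℝ} (hε : 0 < ε) {θ : ℝ → ℝ}
    (hθ : ContDiff ℝ 1 θ) (hθ0 : ∀ s ≤ ε, θ s = 0) {χ : E3 → ℝ} (hχ : ContDiff ℝ 1 χ)
    (hχc : HasCompactSupport χ) :
    ∫ z, χ z * (deriv θ (F z) * ‖∇ F z‖ ^ 2) = -∫ z, θ (F z) * fderiv ℝ χ z (∇ F z) := by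
  have hθ' : ∀ s < ε, deriv θ s = 0 := by
    intro s hs
    have : θ =ᶠ[nhds s] fun _ => 0 := by
      filter_upwards [gt_mem_nhds hs] with r hr
      exact hθ0 r hr.le
    rw [this.deriv_eq]; simp
  have hFd : ∀ z ∈ Ω, DifferentiableAt ℝ F z := fun z hz =>
    (hh z hz).1.differentiableAt (by norm_num)
  have hF'c : ContDiffOn ℝ 1 (fderiv ℝ F) Ω := fun z hz =>
    ((hh z hz).1.fderiv_right (m := 1) (by norm_num)).contDiffWithinAt
  have hgc : ContinuousOn (∇ F) Ω := by
    have : ∇ F = fun z => sharp 3 (fderiv ℝ F z) := funext (gradient_eq_sharp F)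
    rw [this]
    exact (sharp 3).continuous.comp_continuousOn hF'c.continuousOn
  have hΘ : ContDiff ℝ 1 fun z => θ (F z) := by
    refine contDiff_iff_contDiffAt.2 fun z => ?_
    by_cases hz : z ∈ Ω
    · exact hθ.contDiffAt.comp z ((hh z hz).1.of_le (by norm_num))
    · have : (fun z => θ (F z)) =ᶠ[nhds z] fun _ => 0 := by
        filter_upwards [hF.continuousAt.eventually_lt_const (by rw [h0 z hz]; exact hε)] with w hw
        exact hθ0 _ hw.le
      exact contDiffAt_const.congr_of_eventuallyEq this
  set w : E3 → ℝ := fun z => χ z * θ (F z) with hw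
  have hwc : ContDiff ℝ 1 w := hχ.mul hΘ
  have hw0 : ∀ z, F z < ε → fderiv ℝ w z = 0 := by
    intro z hz
    have : w =ᶠ[nhds z] fun _ => 0 := by
      filter_upwards [hF.continuousAt.eventually_lt_const hz] with y hy
      simp [hw, hθ0 _ hy.le]
    rw [this.fderiv_eq]; simp
  -- The support lies in the closed set `{ε ≤ F}`, which misses the complement of `Ω` because `F =
  -- 0` there.
  have hts : tsupport w ⊆ Ω := by
    have h1 : tsupport w ⊆ {z | ε ≤ F z} := by
      refine closure_minimal (fun z hz => ?_) (isClosed_le continuous_const hF)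
      by_contra hlt
      rw [mem_ofPred_eq, not_le] at hlt
      exact hz (by simp [hw, hθ0 _ hlt.le])
    intro z hz
    by_contra hzΩ
    have h2 : ε ≤ F z := h1 hz
    rw [h0 z hzΩ] at h2
    linarith
  have hdw : ∀ z, fderiv ℝ w z (∇ F z) =
      χ z * (deriv θ (F z) * ‖∇ F z‖ ^ 2) + θ (F z) * fderiv ℝ χ z (∇ F z) := by
    intro z
    by_cases hz : z ∈ Ω
    · have h1 := (hθ.differentiable (by norm_num) (F z)).hasDerivAt.comp_hasFDerivAt z
        (hFd z hz).hasFDerivAt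
      have h2 := ((hχ.differentiable (by norm_num) z).hasFDerivAt.fun_mul h1).fderiv
      have h3 : fderiv ℝ F z (∇ F z) = ‖∇ F z‖ ^ 2 := by
        rw [← inner_gradient_left, real_inner_self_eq_norm_sq]
      rw [show w = fun z => χ z * (θ ∘ F) z from rfl, h2]
      simp only [_root_.add_apply, _root_.smul_apply, smul_eq_mul, h3, comp_apply]
    · have h1 : F z < ε := by rw [h0 z hz]; exact hε
      simp [hw0 z h1, hθ' _ h1, hθ0 _ h1.le]
  have hint : ∀ g : E3 → ℝ, ContinuousOn g Ω → (∀ z, F z < ε → g z = 0) →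
      (∀ z, z ∉ tsupport χ → g z = 0) → Integrable g := fun g hg hg0 hgχ =>
    (continuous_of_zero_below hΩ hF h0 hε hg hg0).integrable_of_hasCompactSupport
      (HasCompactSupport.intro hχc hgχ)
  have hwχ : ∀ z, z ∉ tsupport χ → fderiv ℝ w z = 0 := by
    intro z hz
    refine image_eq_zero_of_notMem_tsupport fun h => hz ?_
    exact (tsupport_fderiv_subset ℝ).trans (closure_mono (support_mul_subset_left _ _)) h
  have hθ'c : Continuous (deriv θ) := hθ.continuous_deriv (by norm_num)
  have hI1 : Integrable fun z => χ z * (deriv θ (F z) * ‖∇ F z‖ ^ 2) :=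
    hint _ (hχ.continuous.continuousOn.mul
      ((hθ'c.comp hF).continuousOn.mul (hgc.norm.pow 2))) (fun z hz => by simp [hθ' _ hz])
      (fun z hz => by simp [image_eq_zero_of_notMem_tsupport hz])
  have hI2 : Integrable fun z => θ (F z) * fderiv ℝ χ z (∇ F z) := by
    refine hint _ ((hθ.continuous.comp hF).continuousOn.mul
      ((hχ.continuous_fderiv (by norm_num)).continuousOn.clm_apply hgc))
      (fun z hz => by simp [hθ0 _ hz.le]) (fun z hz => ?_)
    have : fderiv ℝ χ z = 0 :=
      image_eq_zero_of_notMem_tsupport fun h => hz (tsupport_fderiv_subset ℝ h)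
    simp [this]
  set e : Fin 3 → E3 := fun k => EuclideanSpace.single k 1 with he
  have hG : ∀ k, ContDiffOn ℝ 1 (fun z => fderiv ℝ F z (e k)) Ω := fun k =>
    hF'c.clm_apply contDiffOn_const
  have hJ1 : ∀ k, Integrable fun z => fderiv ℝ w z (e k) * fderiv ℝ F z (e k) := fun k =>
    hint _ (((hwc.continuous_fderiv (by norm_num)).clm_apply continuous_const).continuousOn.mul
      (hG k).continuousOn) (fun z hz => by simp [hw0 z hz]) (fun z hz => by simp [hwχ z hz])
  have hJ2 : ∀ k, Integrable fun z => w z * fderiv ℝ (fun y => fderiv ℝ F y (e k)) z (e k) :=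
    fun k => hint _ (hwc.continuous.continuousOn.mul
      (((hG k).continuousOn_fderiv_of_isOpen hΩ (by norm_num)).clm_apply continuousOn_const))
      (fun z hz => by simp [hw, hθ0 _ hz.le])
      (fun z hz => by simp [hw, image_eq_zero_of_notMem_tsupport hz])
  have hJ3 : ∀ k, Integrable fun z => w z * fderiv ℝ F z (e k) := fun k =>
    hint _ (hwc.continuous.continuousOn.mul (hG k).continuousOn)
      (fun z hz => by simp [hw, hθ0 _ hz.le])
      (fun z hz => by simp [hw, image_eq_zero_of_notMem_tsupport hz])
  have hparts : ∀ k, ∫ z, w z * fderiv ℝ (fun y => fderiv ℝ F y (e k)) z (e k) =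
      -∫ z, fderiv ℝ w z (e k) * fderiv ℝ F z (e k) := fun k =>
    integral_mul_fderiv_eq_neg_fderiv_mul_of_integrable (hJ1 k) (hJ2 k) (hJ3 k)
      (fun z _ => hwc.differentiable (by norm_num) z)
      (fun z hz => ((hG k).differentiableOn (by norm_num)).differentiableAt
        (hΩ.mem_nhds (hts hz)))
  have hlap : ∀ z, ∑ k, w z * fderiv ℝ (fun y => fderiv ℝ F y (e k)) z (e k) = 0 := by
    intro z
    by_cases hz : z ∈ Ω
    · have h1 := (hh z hz).2.self_of_nhds
      rw [InnerProductSpace.laplacian_eq_iteratedFDeriv_orthonormalBasis F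
        (EuclideanSpace.basisFun (Fin 3) ℝ)] at h1
      rw [← Finset.mul_sum]
      have h2 : ∀ k, fderiv ℝ (fun y => fderiv ℝ F y (e k)) z (e k) =
          iteratedFDeriv ℝ 2 F z ![EuclideanSpace.basisFun (Fin 3) ℝ k,
            EuclideanSpace.basisFun (Fin 3) ℝ k] := by
        intro k
        have hd : DifferentiableAt ℝ (fderiv ℝ F) z :=
          (hF'c.differentiableOn (by norm_num)).differentiableAt (hΩ.mem_nhds hz)
        rw [iteratedFDeriv_two_apply, fderiv_clm_apply hd (by fun_prop)]
        simp [he]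
      simp_rw [h2]
      exact mul_eq_zero_of_right _ h1
    · have : F z ≤ ε := by rw [h0 z hz]; exact hε.le
      simp [hw, hθ0 _ this]
  have hsum : ∀ z, ∑ k, fderiv ℝ w z (e k) * fderiv ℝ F z (e k) = fderiv ℝ w z (∇ F z) := by
    intro z
    rw [map_E3 (fderiv ℝ w z) (∇ F z), Fin.sum_univ_three]
    simp only [gradient_apply, smul_eq_mul, he]
    ring
  have key : ∫ z, fderiv ℝ w z (∇ F z) = 0 := by
    simp_rw [← hsum]
    rw [integral_finsetSum _ fun k _ => hJ1 k, ← neg_eq_zero, ← Finset.sum_neg_distrib]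
    simp_rw [← hparts]
    rw [← integral_finsetSum _ fun k _ => hJ2 k]
    simp_rw [hlap]
    simp
  simp_rw [hdw] at key
  rw [integral_add hI1 hI2] at key
  linarith

/-- Young's inequality with the exponents `6`, `3` and `2`. -/
theorem mul_mul_le_young {a b c s : ℝ} (hb : 0 ≤ b) (hs : 0 < s) :
    a * b * c ≤ (s ^ 6 + s ^ 2) * (a ^ 6 + c ^ 2) + b ^ 3 / s ^ 6 := by
  -- The rescaling preserves the product `a b c` and leaves the free parameter `s`: large `s` makes
  -- the cubic term small at the cost of the other two.
  set A := s * a with hA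
  set B := b / s ^ 2 with hB
  set C := s * c with hC
  have hB0 : 0 ≤ B := by positivity
  have h1 : a * b * c = A * B * C := by rw [hA, hB, hC]; field_simp
  have h2 : b ^ 3 / s ^ 6 = B ^ 3 := by rw [hB]; field_simp
  have h3 : A * B * C ≤ ((A * B) ^ 2 + C ^ 2) / 2 := by nlinarith [sq_nonneg (A * B - C)]
  have h4 : (A * B) ^ 2 ≤ ((A ^ 2) ^ 3 + 2 * B ^ 3) / 3 := by
    nlinarith [mul_nonneg (sq_nonneg (A ^ 2 - B)) (by positivity : 0 ≤ A ^ 2 + 2 * B)]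
  have h5 : (A ^ 2) ^ 3 = s ^ 6 * a ^ 6 := by rw [hA]; ring
  have h6 : C ^ 2 = s ^ 2 * c ^ 2 := by rw [hC]; ring
  have h7 : 0 ≤ s ^ 6 * c ^ 2 := by positivity
  have h8 : 0 ≤ s ^ 2 * a ^ 6 := by positivity
  have h9 : 0 ≤ s ^ 6 * a ^ 6 := by positivity
  have h10 : 0 ≤ s ^ 2 * c ^ 2 := by positivity
  have h11 : 0 ≤ B ^ 3 := by positivity
  rw [h1, h2]
  nlinarith

theorem tendsto_setIntegral_norm_ge {g : E3 → ℝ} (hg : Integrable g) :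
    Filter.Tendsto (fun n : ℕ => ∫ z in {z : E3 | (n : ℝ) ≤ ‖z‖}, g z) Filter.atTop (nhds 0) := by
  have h := tendsto_setIntegral_of_antitone (μ := volume) (f := g)
    (s := fun n : ℕ => {z : E3 | (n : ℝ) ≤ ‖z‖})
    (fun n => measurableSet_le measurable_const measurable_norm)
    (fun m n hmn z (hz : (n : ℝ) ≤ ‖z‖) => le_trans (Nat.cast_le.2 hmn) hz)
    ⟨0, hg.integrableOn⟩
  have h0 : ⋂ n : ℕ, {z : E3 | (n : ℝ) ≤ ‖z‖} = ∅ := by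
    refine eq_empty_of_forall_notMem fun z hz => ?_
    obtain ⟨n, hn⟩ := exists_nat_gt ‖z‖
    exact absurd (mem_iInter.1 hz n) (not_le.2 hn)
  simpa [h0] using h

/-- Smooth cutoffs at scale `R`, with gradient of size `1 / R`. -/
theorem exists_cutoff : ∃ M : ℝ, 0 ≤ M ∧ ∃ χ : ℝ → E3 → ℝ, ∀ R, 0 < R →
    ContDiff ℝ 1 (χ R) ∧ HasCompactSupport (χ R) ∧ (∀ z, 0 ≤ χ R z) ∧ (∀ z, χ R z ≤ 1) ∧
      (∀ z, ‖z‖ ≤ R → χ R z = 1) ∧ (∀ z, 2 * R ≤ ‖z‖ → χ R z = 0) ∧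
      (∀ z, ‖fderiv ℝ (χ R) z‖ ≤ M / R) ∧ (∀ z, ‖z‖ < R → fderiv ℝ (χ R) z = 0) ∧
      ∀ z, 2 * R < ‖z‖ → fderiv ℝ (χ R) z = 0 := by
  let b : ContDiffBump (0 : E3) := ⟨1, 2, one_pos, one_lt_two⟩
  have hb : ContDiff ℝ 1 b := b.contDiff (n := 1)
  obtain ⟨M, hM⟩ := (b.hasCompactSupport.fderiv ℝ).exists_bound_of_continuous
    (hb.continuous_fderiv (by norm_num))
  refine ⟨M, (norm_nonneg _).trans (hM 0), fun R z => b (R⁻¹ • z), fun R hR => ?_⟩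
  have hn : ∀ z : E3, ‖R⁻¹ • z‖ = ‖z‖ / R := fun z => by
    rw [norm_smul, norm_inv, Real.norm_of_nonneg hR.le, inv_mul_eq_div]
  have h1 : ∀ z, ‖z‖ ≤ R → b (R⁻¹ • z) = 1 := fun z hz => b.one_of_mem_closedBall (by
    rw [mem_closedBall_zero_iff, hn]; exact (div_le_one hR).2 hz)
  have h0 : ∀ z, 2 * R ≤ ‖z‖ → b (R⁻¹ • z) = 0 := fun z hz => b.zero_of_le_dist (by
    rw [dist_zero_right, hn]; exact (le_div_iff₀ hR).2 hz)
  refine ⟨hb.comp (contDiff_const_smul _), ?_, fun z => b.nonneg, fun z => b.le_one, h1, h0,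
    fun z => ?_, fun z hz => ?_, fun z hz => ?_⟩
  · exact b.hasCompactSupport.comp_smul (inv_ne_zero hR.ne')
  · rw [fderiv_comp_smul, norm_smul, norm_inv, Real.norm_of_nonneg hR.le, inv_mul_eq_div]
    gcongr
    exact hM _
  · have : (fun z : E3 => b (R⁻¹ • z)) =ᶠ[nhds z] fun _ => 1 := by
      filter_upwards [continuous_norm.continuousAt.eventually_lt_const hz] with w hw
      exact h1 w (le_of_lt hw)
    rw [this.fderiv_eq]; simp
  · have : (fun z : E3 => b (R⁻¹ • z)) =ᶠ[nhds z] fun _ => 0 := by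
      filter_upwards [continuous_norm.continuousAt.eventually_const_lt hz] with w hw
      exact h0 w (le_of_lt hw)
    rw [this.fderiv_eq]; simp

/-- A nonzero gradient at `z₀` would give the truncated energy a positive lower bound `c`. The
energy identity bounds `c` by the integral of `|F| |∇χ| |∇F|` over `n ≤ ‖z‖ ≤ 2n`. Young's
inequality with exponents 6, 3, 2 splits this into tails of integrable functions, which tend to 0,
and the integral of `|∇χ|³`, which in dimension three is bounded uniformly in `n` and is made small
by the parameter `s`. -/
theorem gradient_eq_zero_of_pos (hΩ : IsOpen Ω) (hF : Continuous F) (h0 : ∀ z ∉ Ω, F z = 0)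
    (hh : InnerProductSpace.HarmonicOnNhd F Ω) (h6 : Integrable fun z => |F z| ^ 6)
    (h2 : IntegrableOn (fun z => ‖∇ F z‖ ^ 2) Ω) {z₀ : E3} (hz₀ : 0 < F z₀) :
    ∇ F z₀ = 0 := by
  by_contra hne
  -- Truncating at half the value `F z₀` leaves `z₀` where `θ'` is positive.
  obtain ⟨θ, hθ, hθ0, hθn, hθp, hθb⟩ := exists_smooth_truncation (half_pos hz₀)
  obtain ⟨M, hM, χ, hχ⟩ := exists_cutoff
  set ε := F z₀ / 2 with hε
  have hε0 : 0 < ε := half_pos hz₀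
  have hθ' : ∀ s < ε, deriv θ s = 0 := by
    intro s hs
    have : θ =ᶠ[nhds s] fun _ => 0 := by
      filter_upwards [gt_mem_nhds hs] with r hr
      exact hθ0 r hr.le
    rw [this.deriv_eq]; simp
  have hgc : ContinuousOn (∇ F) Ω := by
    have : ∇ F = fun z => sharp 3 (fderiv ℝ F z) := funext (gradient_eq_sharp F)
    rw [this]
    refine (sharp 3).continuous.comp_continuousOn fun z hz => ?_
    exact ((hh z hz).1.fderiv_right (m := 1) (by norm_num)).continuousAt.continuousWithinAt
  set Φ : E3 → ℝ := fun z => deriv θ (F z) * ‖∇ F z‖ ^ 2 with hΦ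
  have hΦc : Continuous Φ := continuous_of_zero_below hΩ hF h0 hε0
    ((((hθ.continuous_deriv (by norm_num)).comp hF).continuousOn).mul (hgc.norm.pow 2))
    fun z hz => by simp [hΦ, hθ' _ hz]
  have hΦ0 : ∀ z, 0 ≤ Φ z := fun z => mul_nonneg (hθn _) (by positivity)
  have hΦz : 0 < Φ z₀ := mul_pos (hθp _ (half_lt_self hz₀))
    (by have := norm_pos_iff.2 hne; positivity)
  set R₀ := ‖z₀‖ + 1 with hR₀
  have hR₀0 : 0 < R₀ := by positivity
  have hI : ∀ R, 0 < R → Integrable fun z => χ R z * Φ z := fun R hR =>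
    ((hχ R hR).1.continuous.mul hΦc).integrable_of_hasCompactSupport (hχ R hR).2.1.mul_right
  set c := ∫ z, χ R₀ z * Φ z with hc
  have hc0 : 0 < c := by
    refine Continuous.integral_pos_of_hasCompactSupport_nonneg_nonzero (x := z₀)
      ((hχ R₀ hR₀0).1.continuous.mul hΦc) (hχ R₀ hR₀0).2.1.mul_right
      (fun z => mul_nonneg ((hχ R₀ hR₀0).2.2.1 z) (hΦ0 z)) ?_
    rw [(hχ R₀ hR₀0).2.2.2.2.1 z₀ (by rw [hR₀]; linarith), one_mul]
    exact hΦz.ne'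
  set g : E3 → ℝ := Ω.indicator fun z => |F z| ^ 6 + ‖∇ F z‖ ^ 2 with hg
  have hgi : Integrable g := (h6.integrableOn.add h2).integrable_indicator hΩ.measurableSet
  set V := (volume (Metric.ball (0 : E3) 1)).toReal with hV
  have hV0 : 0 ≤ V := ENNReal.toReal_nonneg
  -- `s` is fixed before `n`: the constant `8 M³ V` is the volume `(2n)³ V` of the ball times `(M /
  -- n)³`, hence free of `n`. The witness satisfies `c s = 16 M³ V + c`, and `s ≤ s ^ 6`.
  obtain ⟨s, hs1, hs⟩ : ∃ s : ℝ, 1 ≤ s ∧ 8 * M ^ 3 * V / s ^ 6 < c / 2 := by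
    refine ⟨16 * M ^ 3 * V / c + 1, by simp; positivity, ?_⟩
    set s := 16 * M ^ 3 * V / c + 1 with hs
    have hs1 : 1 ≤ s := by rw [hs]; simp; positivity
    have h3 : s ≤ s ^ 6 := le_self_pow₀ hs1 (by norm_num)
    rw [div_lt_iff₀ (by positivity)]
    have h4 : c * s = 16 * M ^ 3 * V + c := by rw [hs]; field_simp
    nlinarith
  have hs0 : 0 < s := by linarith
  have main : ∀ n : ℕ, 1 ≤ n → 2 * R₀ ≤ n →
      c ≤ (s ^ 6 + s ^ 2) * (∫ z in {z : E3 | (n : ℝ) ≤ ‖z‖}, g z) + 8 * M ^ 3 * V / s ^ 6 := by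
    intro n hn1 hn2
    have hn0 : (0 : ℝ) < n := by exact_mod_cast hn1
    obtain ⟨hχ1, hχ2, hχ3, -, hχ5, hχ6, hχ7, hχ8, hχ9⟩ := hχ n hn0
    have hmeas : MeasurableSet {z : E3 | (n : ℝ) ≤ ‖z‖} :=
      measurableSet_le measurable_const measurable_norm
    -- The cutoff at scale `R₀` vanishes outside radius `2 R₀ ≤ n`, inside which the cutoff at scale
    -- `n` equals 1.
    have step1 : c ≤ ∫ z, χ n z * Φ z := by
      refine integral_mono (hI _ hR₀0) (hI _ hn0) fun z => ?_
      refine mul_le_mul_of_nonneg_right ?_ (hΦ0 z)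
      rcases le_total (2 * R₀) ‖z‖ with hz | hz
      · rw [(hχ R₀ hR₀0).2.2.2.2.2.1 z hz]; exact hχ3 z
      · rw [hχ5 z (hz.trans hn2)]; exact (hχ R₀ hR₀0).2.2.2.1 z
    rw [integral_cutoff_truncation hΩ hF h0 hh hε0 hθ hθ0 hχ1 hχ2, ← integral_neg] at step1
    have hB : (volume (Metric.closedBall (0 : E3) (2 * n))).toReal = (2 * n) ^ 3 * V := by
      rw [Measure.addHaar_closedBall _ _ (by positivity), ENNReal.toReal_mul,
        ENNReal.toReal_ofReal (by positivity)]
      simp [hV]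
    have hBi : IntegrableOn (fun _ : E3 => (M / n) ^ 3 / s ^ 6)
        (Metric.closedBall (0 : E3) (2 * n)) :=
      integrableOn_const (isCompact_closedBall _ _).measure_lt_top.ne
    have hi1 : Integrable ({z : E3 | (n : ℝ) ≤ ‖z‖}.indicator
        fun z => (s ^ 6 + s ^ 2) * g z) := (hgi.const_mul _).indicator hmeas
    have hi2 : Integrable ((Metric.closedBall (0 : E3) (2 * n)).indicator
        fun _ => (M / n) ^ 3 / s ^ 6) := hBi.integrable_indicator measurableSet_closedBall
    have step2 : ∫ z, -(θ (F z) * fderiv ℝ (χ n) z (∇ F z)) ≤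
        ∫ z, ({z : E3 | (n : ℝ) ≤ ‖z‖}.indicator (fun z => (s ^ 6 + s ^ 2) * g z) z +
          (Metric.closedBall (0 : E3) (2 * n)).indicator (fun _ => (M / n) ^ 3 / s ^ 6) z) := by
      refine (le_abs_self _).trans (abs_integral_le_integral_abs.trans ?_)
      refine integral_mono_of_nonneg (Filter.Eventually.of_forall fun z => abs_nonneg _)
        (hi1.add hi2) (Filter.Eventually.of_forall fun z => ?_)
      have hgn : 0 ≤ g z := indicator_nonneg (fun z _ => by positivity) z
      have hr1 : 0 ≤ {z : E3 | (n : ℝ) ≤ ‖z‖}.indicator (fun z => (s ^ 6 + s ^ 2) * g z) z :=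
        indicator_apply_nonneg fun _ => by positivity
      have hr2 : 0 ≤ (Metric.closedBall (0 : E3) (2 * n)).indicator
          (fun _ => (M / n) ^ 3 / s ^ 6) z := indicator_apply_nonneg fun _ => by positivity
      simp only [abs_neg]
      by_cases hzero : θ (F z) = 0 ∨ fderiv ℝ (χ n) z = 0
      · have : θ (F z) * fderiv ℝ (χ n) z (∇ F z) = 0 := by
          rcases hzero with h | h <;> simp [h]
        rw [this, abs_zero]
        exact add_nonneg hr1 hr2
      · rw [not_or] at hzero
        have hzΩ : z ∈ Ω := by
          by_contra hz
          exact hzero.1 (hθ0 _ (by rw [h0 z hz]; exact hε0.le))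
        have hz1 : (n : ℝ) ≤ ‖z‖ := not_lt.1 fun h => hzero.2 (hχ8 z h)
        have hz2 : ‖z‖ ≤ 2 * n := not_lt.1 fun h => hzero.2 (hχ9 z h)
        rw [indicator_of_mem (show z ∈ {z : E3 | (n : ℝ) ≤ ‖z‖} from hz1),
          indicator_of_mem (mem_closedBall_zero_iff.2 hz2), hg, indicator_of_mem hzΩ, abs_mul]
        calc |θ (F z)| * |fderiv ℝ (χ n) z (∇ F z)| ≤ |F z| * (M / n * ‖∇ F z‖) := by
              refine mul_le_mul (hθb _) ?_ (abs_nonneg _) (abs_nonneg _)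
              exact (ContinuousLinearMap.le_opNorm (fderiv ℝ (χ n) z) (∇ F z)).trans
                (mul_le_mul_of_nonneg_right (hχ7 z) (norm_nonneg _))
          _ = |F z| * (M / n) * ‖∇ F z‖ := by ring
          _ ≤ _ := mul_mul_le_young (by positivity) hs0
    rw [integral_add hi1 hi2, integral_indicator hmeas, integral_indicator
      measurableSet_closedBall, integral_const_mul, setIntegral_const, Measure.real, hB] at step2
    refine step1.trans (step2.trans (le_of_eq ?_))
    rw [smul_eq_mul]
    field_simp
    ring
  have hlim := ((tendsto_setIntegral_norm_ge hgi).const_mul (s ^ 6 + s ^ 2)).eventually_lt_const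
    (u := c / 2) (by simpa using hc0)
  obtain ⟨n, hn1, hn2, hn3⟩ := (hlim.and ((Filter.eventually_ge_atTop 1).and
    (Filter.eventually_ge_atTop ⌈2 * R₀⌉₊))).exists
  have := main n hn2 (Nat.ceil_le.1 hn3)
  linarith

/-- The derivative of `F²` is `2 F dF`, and `dF = 0` wherever `F ≠ 0` (apply the positive case to
`F` or `-F`). Squaring removes any need to control `dF` on the zero set. -/
theorem hasFDerivAt_sq_eq_zero (hΩ : IsOpen Ω) (hF : Continuous F) (h0 : ∀ z ∉ Ω, F z = 0)
    (hh : InnerProductSpace.HarmonicOnNhd F Ω) (h6 : Integrable fun z => |F z| ^ 6)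
    (h2 : IntegrableOn (fun z => ‖∇ F z‖ ^ 2) Ω) {z : E3} (hz : z ∈ Ω) :
    HasFDerivAt (fun z => F z ^ 2) (0 : E3 →L[ℝ] ℝ) z := by
  have hd := ((hh z hz).1.differentiableAt (by norm_num)).hasFDerivAt
  have h1 : F z = 0 ∨ fderiv ℝ F z = 0 := by
    rcases lt_trichotomy (F z) 0 with hlt | heq | hgt
    · right
      have hneg : ∀ w, ∇ (-F) w = -∇ F w := fun w => by
        ext i; rw [gradient_apply, fderiv_neg, PiLp.neg_apply, gradient_apply]; rfl
      have := gradient_eq_zero_of_pos hΩ hF.neg (fun w hw => by simp [h0 w hw]) hh.neg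
        (by simpa using h6) (by simpa [hneg] using h2) (z₀ := z) (by simpa using hlt)
      rw [hneg, neg_eq_zero] at this
      rw [← toDual_gradient, this, map_zero]
    · exact Or.inl heq
    · right
      rw [← toDual_gradient, gradient_eq_zero_of_pos hΩ hF h0 hh h6 h2 hgt, map_zero]
  convert! hd.pow 2 using 1
  rcases h1 with h | h <;> simp [h]

end Energy

/-! ### Uniqueness of the Dirichlet extension -/

theorem isClosed_fluid {η : E2 → ℝ} (hη : Continuous η) : IsClosed (fluid η) := by
  have : fluid η = {z | z 2 ≤ η (horizontalL z)} := by ext; simp [fluid]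
  rw [this]
  exact isClosed_le (by fun_prop) (by fun_prop)

theorem mem_interior_fluid {η : E2 → ℝ} (hη : Continuous η) {z : E3}
    (hz : z 2 < η (horizontal z)) : z ∈ interior (fluid η) := by
  refine mem_interior.2 ⟨{w | w 2 < η (horizontalL w)}, fun w hw => ?_,
    isOpen_lt (by fun_prop) (by fun_prop), by simpa using hz⟩
  have h1 : w 2 < η (horizontalL w) := hw
  rw [horizontalL_apply] at h1
  exact mem_fluid.2 h1.le

theorem eq_surfacePoint_of_notMem_interior {η : E2 → ℝ} (hη : Continuous η) {z : E3}
    (hz : z ∈ fluid η) (hi : z ∉ interior (fluid η)) : z = surfacePoint η (horizontal z) := by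
  have h1 : z 2 = η (horizontal z) :=
    le_antisymm (mem_fluid.1 hz) (not_lt.1 fun h => hi (mem_interior_fluid hη h))
  ext i; fin_cases i <;> simp [h1]

theorem gradD_eq_gradient {η : E2 → ℝ} {f : E3 → ℝ} {z : E3} (hz : z ∈ interior (fluid η)) :
    gradD η f z = ∇ f z := by
  rw [gradD, gradientWithin, gradient, fderivWithin_of_mem_nhds (mem_interior_iff_mem_nhds.1 hz)]

/-- Extend the difference by zero outside the fluid. Its square has zero derivative in the interior,
hence is constant along each vertical segment up to the surface, where it vanishes. -/
theorem IsDirichletExtension.eqOn {η : E2 → ℝ} (hη : Continuous η) {G : E2 → ℝ} {f g : E3 → ℝ}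
    (hf : IsDirichletExtension η G f) (hg : IsDirichletExtension η G g) :
    EqOn f g (fluid η) := by
  set D := fluid η with hD
  set F : E3 → ℝ := D.indicator (f - g) with hFdef
  have hsurf : ∀ x, (f - g) (surfacePoint η x) = 0 := fun x => by
    have h1 := congrFun hf.2 x
    have h2 := congrFun hg.2 x
    simp only [trace] at h1 h2
    simp [h1, h2]
  have hb : ∀ z ∈ D, z ∉ interior D → (f - g) z = 0 := fun z hz hi => by
    rw [eq_surfacePoint_of_notMem_interior hη hz hi]; exact hsurf _
  have hcl := isClosed_fluid hη
  have hF : Continuous F := by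
    refine continuous_indicator (fun z hz => ?_) ?_
    · rw [hcl.frontier_eq] at hz
      exact hb z hz.1 hz.2
    · rw [hcl.closure_eq]
      exact hf.1.contDiff.continuousOn.sub hg.1.contDiff.continuousOn
  have h0 : ∀ z ∉ interior D, F z = 0 := fun z hz => by
    by_cases hzD : z ∈ D
    · rw [hFdef, indicator_of_mem hzD]; exact hb z hzD hz
    · exact indicator_of_notMem hzD _
  have hloc : ∀ z ∈ interior D, F =ᶠ[nhds z] f - g := fun z hz => by
    filter_upwards [mem_interior_iff_mem_nhds.1 hz] with w hw
    exact indicator_of_mem hw _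
  have hh : InnerProductSpace.HarmonicOnNhd F (interior D) := fun z hz =>
    (InnerProductSpace.harmonicAt_congr_nhds (hloc z hz)).2 ((hf.1.harmonic.sub hg.1.harmonic) z hz)
  have h6 : Integrable fun z => |F z| ^ 6 := by
    have h1 := (hf.1.memLp.sub hg.1.memLp).integrable_norm_pow (p := 6) (by norm_num)
    refine (IntegrableOn.integrable_indicator h1 hcl.measurableSet).congr
      (Filter.Eventually.of_forall fun z => ?_)
    by_cases hz : z ∈ D
    · simp only [hFdef, ← hD, indicator_of_mem hz, Real.norm_eq_abs]
    · simp [hFdef, ← hD, indicator_of_notMem hz]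
  have h2 : IntegrableOn (fun z => ‖∇ F z‖ ^ 2) (interior D) := by
    have h1 := (hf.1.memLp_grad.sub hg.1.memLp_grad).integrable_norm_pow (p := 2) (by norm_num)
    have h3 : IntegrableOn (fun z => ‖(gradD η f - gradD η g) z‖ ^ 2) (interior D) :=
      IntegrableOn.mono_set h1 interior_subset
    refine h3.congr_fun (fun z hz => ?_) isOpen_interior.measurableSet
    have hfd := (hf.1.harmonic z hz).1.differentiableAt (by norm_num)
    have hgd := (hg.1.harmonic z hz).1.differentiableAt (by norm_num)
    have : ∇ F z = gradD η f z - gradD η g z := by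
      rw [(hloc z hz).gradient_eq, gradD_eq_gradient hz, gradD_eq_gradient hz]
      ext i
      rw [gradient_apply, fderiv_sub hfd hgd, PiLp.sub_apply, gradient_apply, gradient_apply]
      rfl
    simp [this]
  intro z hz
  have hz2 := mem_fluid.1 hz
  set γ : ℝ → E3 := fun s => z + s • EuclideanSpace.single 2 1 with hγ
  have hγh : ∀ s, horizontal (γ s) = horizontal z := fun s => by
    ext i; fin_cases i <;> simp [hγ]
  have hγ2 : ∀ s, γ s 2 = z 2 + s := fun s => by simp [hγ]
  have hγd : ∀ s, HasDerivAt γ (EuclideanSpace.single 2 1) s := fun s => by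
    have := ((hasDerivAt_id' s).smul_const (EuclideanSpace.single 2 1 : E3)).const_add z
    rwa [one_smul] at this
  have hconst := constant_of_has_deriv_right_zero (f := fun s => F (γ s) ^ 2) (a := 0)
    (b := η (horizontal z) - z 2) ((hF.comp (by fun_prop)).pow 2).continuousOn
    (fun s hs => by
      have hi : γ s ∈ interior D := mem_interior_fluid hη (by
        rw [hγh, hγ2]; linarith [hs.2])
      have := (hasFDerivAt_sq_eq_zero isOpen_interior hF h0 hh h6 h2 hi).comp_hasDerivAt s (hγd s)
      rw [_root_.zero_apply] at this
      exact this.hasDerivWithinAt) (η (horizontal z) - z 2)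
    (right_mem_Icc.2 (by linarith))
  have htop : γ (η (horizontal z) - z 2) = surfacePoint η (horizontal z) := by
    ext i; fin_cases i <;> simp [hγ]
  have hzero : F (surfacePoint η (horizontal z)) = 0 := by
    rw [hFdef, indicator_of_mem (surfacePoint_mem_fluid η _)]; exact hsurf _
  simp only [htop, hzero] at hconst
  have h4 : F z = 0 := by
    have : γ 0 = z := by simp [hγ]
    rw [this] at hconst
    exact pow_eq_zero_iff two_ne_zero |>.1 (by rw [← hconst]; norm_num)
  rw [hFdef, indicator_of_mem hz] at h4
  exact sub_eq_zero.1 h4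

/-- By uniqueness the chosen extension agrees with `f` on the fluid, and derivatives within the
fluid see nothing else. -/
theorem dirichletNeumann_trace {η : E2 → ℝ} (hη : Continuous η) {f : E3 → ℝ}
    (hf : IsHarmonicUnder η f) (x : E2) :
    dirichletNeumann η (trace η f) x = √(1 + ‖∇ η x‖ ^ 2) * normalD η f x := by
  have H : ∃ g, IsDirichletExtension η (trace η f) g := ⟨f, hf, rfl⟩
  have heq : EqOn H.choose f (fluid η) := H.choose_spec.eqOn hη ⟨hf, rfl⟩
  have hx := surfacePoint_mem_fluid η x
  rw [dirichletNeumann, dif_pos H, normalD, normalD, trace, trace, gradD, gradD, gradientWithin,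
    gradientWithin, fderivWithin_congr heq (heq hx)]

/-! ### The space-time strip -/

/-- The strip `[0, T] × ℝ²`. -/
def strip (T : ℝ) : Set (ℝ × E2) := Icc 0 T ×ˢ univ

theorem mem_strip {T t : ℝ} {x : E2} : (t, x) ∈ strip T ↔ t ∈ Icc 0 T := by simp [strip]

theorem convex_strip (T : ℝ) : Convex ℝ (strip T) := (convex_Icc 0 T).prod convex_univ

theorem uniqueDiffOn_strip {T : ℝ} (hT : 0 < T) : UniqueDiffOn ℝ (strip T) :=
  (uniqueDiffOn_Icc hT).prod uniqueDiffOn_univ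

theorem strip_subset_closure_interior {T : ℝ} (hT : 0 < T) :
    strip T ⊆ closure (interior (strip T)) := by
  rw [strip, interior_prod_eq, closure_prod_eq, interior_univ, closure_univ, interior_Icc,
    closure_Ioo hT.ne]

theorem hasFDerivAt_slice {F : Type*} [NormedAddCommGroup F] [NormedSpace ℝ F] {T t : ℝ}
    {x : E2} {f : ℝ × E2 → F} {L : ℝ × E2 →L[ℝ] F} (ht : t ∈ Icc 0 T)
    (hf : HasFDerivWithinAt f L (strip T) (t, x)) :
    HasFDerivAt (fun y => f (t, y)) (L.comp (ContinuousLinearMap.inr ℝ ℝ E2)) x := by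
  rw [← hasFDerivWithinAt_univ]
  exact hf.comp x (hasFDerivAt_prodMk_right t x).hasFDerivWithinAt fun y _ => mem_strip.2 ht

theorem hasDerivWithinAt_slice {F : Type*} [NormedAddCommGroup F] [NormedSpace ℝ F] {T t : ℝ}
    {x : E2} {f : ℝ × E2 → F} {L : ℝ × E2 →L[ℝ] F}
    (hf : HasFDerivWithinAt f L (strip T) (t, x)) :
    HasDerivWithinAt (fun s => f (s, x)) (L (1, 0)) (Icc 0 T) t := by
  have h := hf.comp t (hasFDerivAt_prodMk_left t x).hasFDerivWithinAt
    fun s (hs : s ∈ Icc 0 T) => mem_strip.2 hs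
  convert! h.hasDerivWithinAt using 1

theorem map_strip {F : Type*} [NormedAddCommGroup F] [NormedSpace ℝ F] (L : ℝ × E2 →L[ℝ] F)
    (a : ℝ × E2) :
    L a = a.1 • L (1, 0) + a.2 0 • L (0, EuclideanSpace.single 0 1)
      + a.2 1 • L (0, EuclideanSpace.single 1 1) := by
  rw [← map_smul, ← map_smul, ← map_smul, ← map_add, ← map_add]
  congr 1
  ext i
  · simp
  · fin_cases i <;> simp

/-- A `C¹` one-form on the strip whose coefficients satisfy the cross-derivative identities is
exact. -/
theorem exists_primitive_strip {T : ℝ} {W₀ W₁ Q : ℝ × E2 → ℝ}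
    {W₀' W₁' Q' : ℝ × E2 → ℝ × E2 →L[ℝ] ℝ}
    (h₀ : ∀ q ∈ strip T, HasFDerivWithinAt W₀ (W₀' q) (strip T) q)
    (h₁ : ∀ q ∈ strip T, HasFDerivWithinAt W₁ (W₁' q) (strip T) q)
    (hQ : ∀ q ∈ strip T, HasFDerivWithinAt Q (Q' q) (strip T) q)
    (h₀₁ : ∀ q ∈ strip T, W₁' q (0, EuclideanSpace.single 0 1) =
      W₀' q (0, EuclideanSpace.single 1 1))
    (hQ₀ : ∀ q ∈ strip T, W₀' q (1, 0) = Q' q (0, EuclideanSpace.single 0 1))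
    (hQ₁ : ∀ q ∈ strip T, W₁' q (1, 0) = Q' q (0, EuclideanSpace.single 1 1)) :
    ∃ f : ℝ × E2 → ℝ, ∀ t ∈ Icc 0 T, ∀ x,
      HasGradientAt (fun y => f (t, y)) !₂[W₀ (t, x), W₁ (t, x)] x ∧
      HasDerivWithinAt (fun s => f (s, x)) (Q (t, x)) (Icc 0 T) t := by
  let π (i : Fin 2) : ℝ × E2 →L[ℝ] ℝ :=
    (EuclideanSpace.proj i : E2 →L[ℝ] ℝ).comp (ContinuousLinearMap.snd ℝ ℝ E2)
  let τ : ℝ × E2 →L[ℝ] ℝ := ContinuousLinearMap.fst ℝ ℝ E2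
  have hΘ : ∀ q ∈ strip T, HasFDerivWithinAt
      (fun q => W₀ q • π 0 + W₁ q • π 1 + Q q • τ)
      ((W₀' q).smulRight (π 0) + (W₁' q).smulRight (π 1) + (Q' q).smulRight τ) (strip T) q :=
    fun q hq => (((h₀ q hq).smul_const (π 0)).add ((h₁ q hq).smul_const (π 1))).add
      ((hQ q hq).smul_const τ)
  obtain ⟨f, hf⟩ := (convex_strip T).exists_forall_hasFDerivWithinAt_of_hasFDerivWithinAt_symmetric
    hΘ (fun q hq a _ b _ => by
      rw [map_strip _ a, map_strip _ b]
      simp only [_root_.add_apply, _root_.smul_apply, ContinuousLinearMap.smulRight_apply,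
        ContinuousLinearMap.comp_apply, ContinuousLinearMap.coe_snd', ContinuousLinearMap.coe_fst',
        PiLp.proj_apply, smul_eq_mul, π, τ]
      have e0 := h₀₁ q hq
      have e1 := hQ₀ q hq
      have e2 := hQ₁ q hq
      rw [map_strip (W₀' q) b, map_strip (W₁' q) b, map_strip (Q' q) b]
      simp
      -- The weights are the two-by-two minors of `(a, b)`, that is, the values of the basic
      -- two-forms on this pair.
      linear_combination (a.2 0 * b.2 1 - a.2 1 * b.2 0) * e0 + (a.1 * b.2 0 - b.1 * a.2 0) * e1 +
        (a.1 * b.2 1 - b.1 * a.2 1) * e2)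
  refine ⟨f, fun t ht x => ⟨?_, ?_⟩⟩
  · refine hasGradientAt_of_hasFDerivAt (hasFDerivAt_slice ht (hf _ (mem_strip.2 ht))) fun i => ?_
    fin_cases i <;> simp [π, τ]
  · simpa [π, τ] using hasDerivWithinAt_slice (hf _ (mem_strip.2 ht))

/-! ### Evolution of the trace of the velocity -/

section Flow

variable {T : ℝ} {h : ℝ → E2 → ℝ} {v : ℝ → E3 → E3} {p : ℝ → E3 → ℝ}

theorem IsEulerFlow.contDiff_slice (hflow : IsEulerFlow T h v p) {t : ℝ} (ht : t ∈ Icc 0 T) :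
    ContDiff ℝ 2 (h t) := by
  rw [← contDiffOn_univ]
  exact hflow.contDiff_surface.comp (contDiff_prodMk_right t).contDiffOn fun x _ => ⟨ht, mem_univ x⟩

theorem IsEulerFlow.hasFDerivWithinAt_surface (hflow : IsEulerFlow T h v p) {q : ℝ × E2}
    (hq : q ∈ strip T) :
    HasFDerivWithinAt (uncurry h) (fderivWithin ℝ (uncurry h) (strip T) q) (strip T) q :=
  (hflow.contDiff_surface.differentiableOn (by norm_num) q hq).hasFDerivWithinAt

theorem IsEulerFlow.gradient_surface (hflow : IsEulerFlow T h v p) {t : ℝ} (ht : t ∈ Icc 0 T)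
    (x : E2) (i : Fin 2) : (∇ (h t) x) i =
      fderivWithin ℝ (uncurry h) (strip T) (t, x) (0, EuclideanSpace.single i 1) := by
  have h1 := hasFDerivAt_slice ht (hflow.hasFDerivWithinAt_surface (mem_strip.2 ht : (t, x) ∈ _))
  simp only [uncurry_apply_pair] at h1
  rw [gradient_apply, h1.fderiv]
  simp

theorem IsEulerFlow.hasDerivWithinAt_surface (hflow : IsEulerFlow T h v p) {t : ℝ}
    (ht : t ∈ Icc 0 T) (x : E2) : HasDerivWithinAt (fun s => h s x)
      (fderivWithin ℝ (uncurry h) (strip T) (t, x) (1, 0)) (Icc 0 T) t :=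
  hasDerivWithinAt_slice (hflow.hasFDerivWithinAt_surface (mem_strip.2 ht : (t, x) ∈ _))

/-- The trace of the velocity on the free surface, as a function on the strip. -/
noncomputable def velocityTrace (h : ℝ → E2 → ℝ) (v : ℝ → E3 → E3) (q : ℝ × E2) : E3 :=
  v q.1 (surfacePoint (h q.1) q.2)

theorem IsEulerFlow.kinematic_strip (hflow : IsEulerFlow T h v p) (hT : 0 < T) {q : ℝ × E2}
    (hq : q ∈ strip T) :
    fderivWithin ℝ (uncurry h) (strip T) q (1, 0) = velocityTrace h v q 2
      - velocityTrace h v q 0 *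
          fderivWithin ℝ (uncurry h) (strip T) q (0, EuclideanSpace.single 0 1)
      - velocityTrace h v q 1 *
          fderivWithin ℝ (uncurry h) (strip T) q (0, EuclideanSpace.single 1 1) := by
  obtain ⟨t, x⟩ := q
  have ht := mem_strip.1 hq
  have h1 := hflow.kinematic t ht x
  rw [(hflow.hasDerivWithinAt_surface ht x).derivWithin (uniqueDiffOn_Icc hT t ht),
    hflow.gradient_surface ht, hflow.gradient_surface ht] at h1
  simp only [velocityTrace]
  linarith

/-- Chain rule along `(t, x) ↦ (t, x, h t x)`: since the surface moves, the time derivative picks up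
the vertical derivative of `v` times `∂_t h`. -/
theorem IsEulerFlow.hasFDerivWithinAt_velocityTrace (hflow : IsEulerFlow T h v p) {t : ℝ}
    (ht : t ∈ Icc 0 T) (x : E2) :
    ∃ L : ℝ × E2 →L[ℝ] E3, HasFDerivWithinAt (velocityTrace h v) L (strip T) (t, x) ∧
      L (1, 0) = timeD T h v t (surfacePoint (h t) x) +
        fderivWithin ℝ (uncurry h) (strip T) (t, x) (1, 0) •
          partialD (h t) 2 (v t) (surfacePoint (h t) x) ∧
      ∀ i : Fin 2, L (0, EuclideanSpace.single i 1) =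
        partialD (h t) i.castSucc (v t) (surfacePoint (h t) x) +
          (∇ (h t) x) i • partialD (h t) 2 (v t) (surfacePoint (h t) x) := by
  set z := surfacePoint (h t) x with hz
  have hzm : (t, z) ∈ spaceTime T h := ⟨ht, surfacePoint_mem_fluid _ _⟩
  have hD := (hflow.contDiff_velocity.differentiableOn (by norm_num) _ hzm).hasFDerivWithinAt
  set D := fderivWithin ℝ (uncurry v) (spaceTime T h) (t, z)
  have hH := hflow.hasFDerivWithinAt_surface (mem_strip.2 ht : (t, x) ∈ strip T)
  set H' := fderivWithin ℝ (uncurry h) (strip T) (t, x) with hH'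
  have hσ : HasFDerivWithinAt (fun q : ℝ × E2 => (q.1, surfacePoint (h q.1) q.2))
      ((ContinuousLinearMap.fst ℝ ℝ E2).prod (liftL.comp (ContinuousLinearMap.snd ℝ ℝ E2) +
        H'.smulRight (EuclideanSpace.single 2 1))) (strip T) (t, x) := by
    refine hasFDerivAt_fst.hasFDerivWithinAt.prodMk ?_
    simp_rw [surfacePoint_eq]
    exact (liftL.hasFDerivAt.comp_hasFDerivWithinAt _ hasFDerivAt_snd.hasFDerivWithinAt).add
      (hH.smul_const (EuclideanSpace.single 2 1 : E3))
  have hP : ∀ w : E3, D (0, w) = fderivWithin ℝ (v t) (fluid (h t)) z w := by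
    intro w
    have h1 : HasFDerivWithinAt (v t) (D.comp (ContinuousLinearMap.inr ℝ ℝ E3)) (fluid (h t)) z :=
      hD.comp z (hasFDerivAt_prodMk_right t z).hasFDerivWithinAt fun w hw => ⟨ht, hw⟩
    rw [h1.fderivWithin (uniqueDiffOn_fluid ((hflow.contDiff_slice ht).differentiable
      (by norm_num)) z (surfacePoint_mem_fluid _ _))]
    simp
  have hmaps : MapsTo (fun q : ℝ × E2 => (q.1, surfacePoint (h q.1) q.2)) (strip T)
      (spaceTime T h) := fun q hq => ⟨hq.1, surfacePoint_mem_fluid _ _⟩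
  have hcomp := HasFDerivWithinAt.comp (t, x) hD hσ hmaps
  refine ⟨_, hcomp, ?_, fun i => ?_⟩
  · have : ((1 : ℝ), H' (1, 0) • (EuclideanSpace.single 2 1 : E3)) =
        ((1 : ℝ), (0 : E3)) + H' (1, 0) • ((0 : ℝ), (EuclideanSpace.single 2 1 : E3)) := by simp
    simp only [ContinuousLinearMap.comp_apply, ContinuousLinearMap.prod_apply, _root_.add_apply,
      ContinuousLinearMap.smulRight_apply, ContinuousLinearMap.coe_fst',
      ContinuousLinearMap.coe_snd', map_zero, zero_add]
    rw [this, map_add, map_smul, hP]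
    rfl
  · simp only [ContinuousLinearMap.comp_apply, ContinuousLinearMap.prod_apply, _root_.add_apply,
      ContinuousLinearMap.smulRight_apply, ContinuousLinearMap.coe_fst',
      ContinuousLinearMap.coe_snd']
    rw [hP, map_add, map_smul, hflow.gradient_surface ht]
    have : (liftL (EuclideanSpace.single i 1) : E3) = EuclideanSpace.single i.castSucc 1 := by
      ext j; fin_cases i <;> fin_cases j <;> simp
    rw [this]
    rfl

/-- As `p` vanishes along the surface, so does the tangential part of its gradient. -/
theorem IsEulerFlow.pressure_gradient (hflow : IsEulerFlow T h v p) {t : ℝ} (ht : t ∈ Icc 0 T)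
    (x : E2) (i : Fin 2) :
    gradD (h t) (p t) (surfacePoint (h t) x) i.castSucc =
      -gradD (h t) (p t) (surfacePoint (h t) x) 2 * (∇ (h t) x) i := by
  have h1 := hasGradientAt_trace ((hflow.contDiff_slice ht).differentiable (by norm_num))
    ((hflow.contDiff_pressure t ht).differentiableOn (by norm_num) _
      (surfacePoint_mem_fluid (h t) x))
  have h2 : trace (h t) (p t) = fun _ => 0 := funext fun x => hflow.vacuum t ht x
  rw [h2] at h1
  have h3 := congrArg (fun w : E2 => w i) (h1.unique (hasGradientAt_const x (0 : ℝ)))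
  simp only [tangentialTrace, PiLp.add_apply, PiLp.smul_apply, smul_eq_mul, PiLp.zero_apply] at h3
  have h4 : horizontal (gradD (h t) (p t) (surfacePoint (h t) x)) i =
      gradD (h t) (p t) (surfacePoint (h t) x) i.castSucc := by fin_cases i <;> rfl
  rw [h4] at h3
  linarith

/-- Euler's equations on the free surface. -/
theorem IsEulerFlow.euler_trace (hflow : IsEulerFlow T h v p) (hT : 0 < T) {q : ℝ × E2}
    (hq : q ∈ strip T) :
    ∃ L : ℝ × E2 →L[ℝ] E3, ∃ a : ℝ, HasFDerivWithinAt (velocityTrace h v) L (strip T) q ∧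
      (∀ i : Fin 2, L (1, 0) i.castSucc +
        velocityTrace h v q 0 * L (0, EuclideanSpace.single 0 1) i.castSucc +
        velocityTrace h v q 1 * L (0, EuclideanSpace.single 1 1) i.castSucc =
          -a * fderivWithin ℝ (uncurry h) (strip T) q (0, EuclideanSpace.single i 1)) ∧
      L (1, 0) 2 + velocityTrace h v q 0 * L (0, EuclideanSpace.single 0 1) 2 +
        velocityTrace h v q 1 * L (0, EuclideanSpace.single 1 1) 2 = a - 1 ∧
      (normalVorticity (h q.1) (v q.1) q.2 = 0 →
        L (0, EuclideanSpace.single 0 1) 1 + L (0, EuclideanSpace.single 0 1) 2 *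
          fderivWithin ℝ (uncurry h) (strip T) q (0, EuclideanSpace.single 1 1) =
        L (0, EuclideanSpace.single 1 1) 0 + L (0, EuclideanSpace.single 1 1) 2 *
          fderivWithin ℝ (uncurry h) (strip T) q (0, EuclideanSpace.single 0 1)) := by
  obtain ⟨t, x⟩ := q
  have ht := mem_strip.1 hq
  obtain ⟨L, hL, hLt, hLx⟩ := hflow.hasFDerivWithinAt_velocityTrace ht x
  have hkin := hflow.kinematic_strip hT hq
  have hmom := hflow.momentum t ht _ (surfacePoint_mem_fluid (h t) x)
  have hp := hflow.pressure_gradient ht x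
  have hc0 := hLx 0
  have hc1 := hLx 1
  simp only [← hflow.gradient_surface ht] at hkin ⊢
  have hmomi : ∀ j : Fin 3, timeD T h v t (surfacePoint (h t) x) j +
      (velocityTrace h v (t, x) 0 * partialD (h t) 0 (v t) (surfacePoint (h t) x) j +
       velocityTrace h v (t, x) 1 * partialD (h t) 1 (v t) (surfacePoint (h t) x) j +
       velocityTrace h v (t, x) 2 * partialD (h t) 2 (v t) (surfacePoint (h t) x) j) =
      -gradD (h t) (p t) (surfacePoint (h t) x) j - (EuclideanSpace.single 2 1 : E3) j := by
    intro j
    have := congrArg (fun w : E3 => w j) hmom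
    simpa [Fin.sum_univ_three, velocityTrace] using this
  -- The coefficient `a` is `-∂₃p`. The kinematic condition cancels every vertical derivative of `v`
  -- in the material derivative, leaving only horizontal transport of the trace.
  refine ⟨L, -gradD (h t) (p t) (surfacePoint (h t) x) 2, hL, fun i => ?_, ?_, fun hω => ?_⟩
  · rw [hLt, hc0, hc1, hkin]
    have h1 := hmomi i.castSucc
    have h2 := hp i
    have h3 : (EuclideanSpace.single 2 1 : E3) i.castSucc = 0 := by fin_cases i <;> simp
    rw [h2, h3] at h1
    simp only [PiLp.add_apply, PiLp.smul_apply, smul_eq_mul, Fin.castSucc_zero, Fin.castSucc_one]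
    linear_combination h1
  · rw [hLt, hc0, hc1, hkin]
    have h1 := hmomi 2
    have h3 : (EuclideanSpace.single 2 1 : E3) 2 = 1 := by simp
    rw [h3] at h1
    simp only [PiLp.add_apply, PiLp.smul_apply, smul_eq_mul, Fin.castSucc_zero, Fin.castSucc_one]
    linear_combination h1
  · have h1 := sqrt_mul_inner_unitNormal (h t) x (trace (h t) (curlD (h t) (v t)) x)
    rw [real_inner_comm, show inner ℝ (trace (h t) (curlD (h t) (v t)) x) (unitNormal (h t) x) = 0
      from hω, mul_zero] at h1
    rw [hc0, hc1]
    simp [trace, curlD] at h1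
    simp only [PiLp.add_apply, PiLp.smul_apply, smul_eq_mul, Fin.castSucc_zero, Fin.castSucc_one]
    linear_combination -h1

/-- The right-hand side of the evolution equation of the surface potential, in terms of the trace
of the velocity. -/
noncomputable def bernoulli (h : ℝ → E2 → ℝ) (v : ℝ → E3 → E3) (q : ℝ × E2) : ℝ :=
  -h q.1 q.2 - 1 / 2 * (velocityTrace h v q 0 ^ 2 + velocityTrace h v q 1 ^ 2)
    + 1 / 2 * velocityTrace h v q 2 ^ 2
    - velocityTrace h v q 2 * (velocityTrace h v q 0 * (∇ (h q.1) q.2) 0 +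
        velocityTrace h v q 1 * (∇ (h q.1) q.2) 1)

/-- Closedness of the one-form has two parts. The purely spatial one is `ω · n = 0`. For the mixed
ones, adding `∂_i h` times the vertical Euler equation to the horizontal one cancels the pressure
and leaves `-∂_i h` from gravity; the remaining terms match by the spatial derivative of the
kinematic condition and, once more, by `ω · n = 0`. -/
theorem IsEulerFlow.exists_potential (hflow : IsEulerFlow T h v p) (hT : 0 < T)
    (hω : ∀ t ∈ Icc 0 T, ∀ x, normalVorticity (h t) (v t) x = 0) :
    ∃ f : ℝ × E2 → ℝ, ∀ t ∈ Icc 0 T, ∀ x,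
      HasGradientAt (fun y => f (t, y)) (tangentialTrace (h t) (v t) x) x ∧
      HasDerivWithinAt (fun s => f (s, x)) (bernoulli h v (t, x)) (Icc 0 T) t := by
  have hU := uniqueDiffOn_strip hT
  choose! L a hL hE hE2 hcurl using fun q (hq : q ∈ strip T) => hflow.euler_trace hT hq
  set N := velocityTrace h v with hN
  set H' := fderivWithin ℝ (uncurry h) (strip T) with hH'
  set H'' := fderivWithin ℝ H' (strip T) with hH''
  set e : Fin 2 → ℝ × E2 := fun i => (0, EuclideanSpace.single i 1) with he
  have hH2 : ∀ q ∈ strip T, HasFDerivWithinAt H' (H'' q) (strip T) q := fun q hq =>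
    ((hflow.contDiff_surface.fderivWithin hU (m := 1) (by norm_num)).differentiableOn
      (by norm_num) q hq).hasFDerivWithinAt
  have hsymm : ∀ q ∈ strip T, ∀ b c, H'' q b c = H'' q c b := fun q hq =>
    (hflow.contDiff_surface q hq).isSymmSndFDerivWithinAt (by simp) hU
      (strip_subset_closure_interior hT hq) hq
  have hg : ∀ b, ∀ q ∈ strip T, HasFDerivWithinAt (fun q => H' q b)
      ((ContinuousLinearMap.apply ℝ ℝ b).comp (H'' q)) (strip T) q := fun b q hq =>
    (ContinuousLinearMap.apply ℝ ℝ b).hasFDerivAt.comp_hasFDerivWithinAt q (hH2 q hq)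
  have hNj : ∀ j, ∀ q ∈ strip T, HasFDerivWithinAt (fun q => N q j)
      ((EuclideanSpace.proj j : E3 →L[ℝ] ℝ).comp (L q)) (strip T) q := fun j q hq =>
    (EuclideanSpace.proj j : E3 →L[ℝ] ℝ).hasFDerivAt.comp_hasFDerivWithinAt q (hL q hq)
  -- The kinematic condition differentiated within the strip; unique differentiability makes this
  -- legitimate at `t = 0` and `t = T` too.
  have hkin : ∀ q ∈ strip T, ∀ b, H'' q b (1, 0) = L q b 2
      - (N q 0 * H'' q b (e 0) + L q b 0 * H' q (e 0))
      - (N q 1 * H'' q b (e 1) + L q b 1 * H' q (e 1)) := by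
    intro q hq b
    have h1 := ((hNj 2 q hq).sub ((hNj 0 q hq).fun_mul (hg (e 0) q hq))).sub
      ((hNj 1 q hq).fun_mul (hg (e 1) q hq))
    have h2 := h1.congr (fun r hr => hflow.kinematic_strip hT hr) (hflow.kinematic_strip hT hq)
    have h3 := congrArg (fun l : ℝ × E2 →L[ℝ] ℝ => l b) ((hU q hq).eq (hg (1, 0) q hq) h2)
    simp at h3
    rw [h3]; ring
  have hW : ∀ i : Fin 2, ∀ q ∈ strip T, HasFDerivWithinAt
      (fun q => N q i.castSucc + N q 2 * H' q (e i)) _ (strip T) q := fun i q hq =>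
    (hNj i.castSucc q hq).add ((hNj 2 q hq).fun_mul (hg (e i) q hq))
  have hQ : ∀ q ∈ strip T, HasFDerivWithinAt
      (fun q => -uncurry h q - 1 / 2 * (N q 0 * N q 0 + N q 1 * N q 1) + 1 / 2 * (N q 2 * N q 2) -
        N q 2 * (N q 0 * H' q (e 0) + N q 1 * H' q (e 1))) _ (strip T) q := fun q hq =>
    (((hflow.hasFDerivWithinAt_surface hq).fun_neg.sub
      ((((hNj 0 q hq).fun_mul (hNj 0 q hq)).add ((hNj 1 q hq).fun_mul (hNj 1 q hq))).const_mul (1 / 2))).add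
      (((hNj 2 q hq).fun_mul (hNj 2 q hq)).const_mul (1 / 2))).sub
      ((hNj 2 q hq).fun_mul (((hNj 0 q hq).fun_mul (hg (e 0) q hq)).add
        ((hNj 1 q hq).fun_mul (hg (e 1) q hq))))
  obtain ⟨f, hf⟩ := exists_primitive_strip (hW 0) (hW 1) hQ
    (fun q hq => by
      have h1 := hcurl q hq (hω q.1 hq.1 q.2)
      have h2 := hsymm q hq (e 0) (e 1)
      simp [he] at h1 h2 ⊢
      linear_combination h1 + N q 2 * h2)
    (fun q hq => by
      have h1 := hcurl q hq (hω q.1 hq.1 q.2)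
      have h2 := hsymm q hq (1, 0) (e 0)
      have h3 := hE q hq 0
      have h4 := hE2 q hq
      have h5 := hkin q hq (e 0)
      simp [he] at h1 h2 h3 h4 h5 ⊢
      linear_combination h3 + H' q (e 0) * h4 + N q 2 * (h2 + h5) + N q 1 * h1)
    (fun q hq => by
      have h1 := hcurl q hq (hω q.1 hq.1 q.2)
      have h2 := hsymm q hq (1, 0) (e 1)
      have h3 := hE q hq 1
      have h4 := hE2 q hq
      have h5 := hkin q hq (e 1)
      simp [he] at h1 h2 h3 h4 h5 ⊢
      linear_combination h3 + H' q (e 1) * h4 + N q 2 * (h2 + h5) - N q 0 * h1)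
  refine ⟨f, fun t ht x => ?_⟩
  convert! hf t ht x using 2
  · ext i
    fin_cases i <;>
      simp [tangentialTrace, hflow.gradient_surface ht, hN, velocityTrace, he, hH']
  · simp [bernoulli, hflow.gradient_surface ht, he, hH', hN]
    ring

end Flow

/-! ### Boundary identities for the rotational part -/

theorem normalD_mul_sqrt (η : E2 → ℝ) (f : E3 → ℝ) (x : E2) :
    √(1 + ‖∇ η x‖ ^ 2) * normalD η f x = gradD η f (surfacePoint η x) 2
      - (∇ η x) 0 * gradD η f (surfacePoint η x) 0
      - (∇ η x) 1 * gradD η f (surfacePoint η x) 1 := by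
  rw [normalD, sqrt_mul_inner_unitNormal]; rfl

theorem tangentialTrace_rotational (η : E2 → ℝ) (u : E3 → E3) (f : E3 → ℝ) (x : E2) :
    tangentialTrace η (gradD η f) x + tangentialTrace η (rotational η u f) x =
      tangentialTrace η u x := by
  ext i
  fin_cases i <;> simp [tangentialTrace, rotational] <;> ring

section Flow

variable {T : ℝ} {h : ℝ → E2 → ℝ} {v : ℝ → E3 → E3} {p : ℝ → E3 → ℝ}

theorem IsEulerFlow.contDiffOn_velocity_slice (hflow : IsEulerFlow T h v p) {t : ℝ}
    (ht : t ∈ Icc 0 T) : ContDiffOn ℝ 1 (v t) (fluid (h t)) :=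
  hflow.contDiff_velocity.comp (contDiff_prodMk_right t).contDiffOn fun _ hz => ⟨ht, hz⟩

theorem IsEulerFlow.curl2_Uω (hflow : IsEulerFlow T h v p) {t : ℝ} (ht : t ∈ Icc 0 T)
    {f : E3 → ℝ} (hf : IsHarmonicUnder (h t) f) :
    Differentiable ℝ (Uω (h t) (v t) f) ∧
      ∀ x, curl2 (Uω (h t) (v t) f) x
        = √(1 + ‖∇ (h t) x‖ ^ 2) * normalVorticity (h t) (v t) x := by
  have hη := hflow.contDiff_slice ht
  have hηd := hη.differentiable (by norm_num)
  have hv := (hflow.contDiffOn_velocity_slice ht).differentiableOn (by norm_num)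
  have hr : DifferentiableOn ℝ (rotational (h t) (v t) f) (fluid (h t)) :=
    hv.sub ((contDiffOn_gradD hηd hf.contDiff).differentiableOn (by norm_num))
  rw [Uω_eq_tangentialTrace]
  refine ⟨fun x => (hasFDerivAt_tangentialTrace hη
    (hr _ (surfacePoint_mem_fluid _ x))).differentiableAt, fun x => ?_⟩
  rw [curl2_tangentialTrace hη (hr _ (surfacePoint_mem_fluid _ x)), normalVorticity,
    normalVorticity, trace, trace, curlD_rotational hηd hv hf.contDiff (surfacePoint_mem_fluid _ x)]

/-- The kinematic condition gives `∂_t h` as the rescaled normal velocity; the Neumann condition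
replaces `v · n` by the normal derivative of the extension. -/
theorem IsEulerFlow.hasDerivWithinAt_dirichletNeumann (hflow : IsEulerFlow T h v p) (hT : 0 < T)
    {t : ℝ} (ht : t ∈ Icc 0 T) {f : E3 → ℝ} (hf : IsNeumannExtension (h t) (v t) f) (x : E2) :
    HasDerivWithinAt (fun s => h s x) (dirichletNeumann (h t) (trace (h t) f) x) (Icc 0 T) t := by
  have h1 := hflow.hasDerivWithinAt_surface ht x
  rw [hflow.kinematic_strip hT (mem_strip.2 ht), ← hflow.gradient_surface ht,
    ← hflow.gradient_surface ht] at h1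
  rw [dirichletNeumann_trace (hflow.contDiff_slice ht).continuous hf.1, hf.2,
    sqrt_mul_inner_unitNormal]
  convert! h1 using 1
  simp only [trace, velocityTrace]
  ring

/-- The evolution equation's right-hand side is the Bernoulli function of the trace of `v`. -/
theorem zakharovRHS_add_Rω {η : E2 → ℝ} (hη : Differentiable ℝ η) {u : E3 → E3} {f : E3 → ℝ}
    (hf : IsNeumannExtension η u f) (x : E2) :
    zakharovRHS η (trace η f) x + Rω η (trace η f) (Vω η u f) x =
      -η x - 1 / 2 * (trace η u x 0 ^ 2 + trace η u x 1 ^ 2) + 1 / 2 * trace η u x 2 ^ 2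
        - trace η u x 2 * (trace η u x 0 * (∇ η x) 0 + trace η u x 1 * (∇ η x) 1) := by
  have hN : √(1 + ‖∇ η x‖ ^ 2) * normalD η f x =
      √(1 + ‖∇ η x‖ ^ 2) * inner ℝ (unitNormal η x) (trace η u x) := by rw [hf.2]
  have hgrad : ∇ (trace η f) x = tangentialTrace η (gradD η f) x :=
    (hasGradientAt_trace hη (hf.1.contDiff.differentiableOn (by norm_num) _
      (surfacePoint_mem_fluid η x))).gradient
  rw [normalD_mul_sqrt, sqrt_mul_inner_unitNormal] at hN
  rw [zakharovRHS, Rω, dirichletNeumann_trace hη.continuous hf.1, normalD_mul_sqrt, hgrad]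
  have hV0 : Vω η u f x 0 = trace η u x 0 - gradD η f (surfacePoint η x) 0 := rfl
  have hV1 : Vω η u f x 1 = trace η u x 1 - gradD η f (surfacePoint η x) 1 := rfl
  have hW0 : tangentialTrace η (gradD η f) x 0 = gradD η f (surfacePoint η x) 0 +
    gradD η f (surfacePoint η x) 2 * (∇ η x) 0 := rfl
  have hW1 : tangentialTrace η (gradD η f) x 1 = gradD η f (surfacePoint η x) 1 +
    gradD η f (surfacePoint η x) 2 * (∇ η x) 1 := rfl
  simp only [EuclideanSpace.real_norm_sq_eq, PiLp.inner_apply, Fin.sum_univ_two, RCLike.inner_apply,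
    conj_trivial, hV0, hV1, hW0, hW1]
  have hpos : (1 : ℝ) + ((∇ η x) 0 ^ 2 + (∇ η x) 1 ^ 2) ≠ 0 := by positivity
  -- The Neumann condition, solved for the vertical velocity. The quotient in the equation is
  -- harmless because `G(η)φ + ∇η · ∇φ = (1 + |∇η|²) ∂₃f`; what is left is polynomial.
  have hN2 : trace η u x 2 = gradD η f (surfacePoint η x) 2
      - (∇ η x) 0 * gradD η f (surfacePoint η x) 0 - (∇ η x) 1 * gradD η f (surfacePoint η x) 1
      + (∇ η x) 0 * trace η u x 0 + (∇ η x) 1 * trace η u x 1 := by linarith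
  rw [hN2]
  field_simp
  ring

end Flow

end WaterWaves

/-! ### Proof of the theorem -/

open WaterWaves
theorem mainTheorem3 (T : ℝ) (hT : 0 < T) (h : ℝ → E2 → ℝ) (v : ℝ → E3 → E3) (p : ℝ → E3 → ℝ)
    (hflow : IsEulerFlow T h v p)
    (ψ : ℝ → E3 → ℝ) (hψ : ∀ t ∈ Icc 0 T, IsNeumannExtension (h t) (v t) (ψ t))
    (φ : ℝ → E2 → ℝ) (hφ : ∀ t, φ t = trace (h t) (ψ t)) :
    (∀ t ∈ Icc 0 T, Differentiable ℝ (Uω (h t) (v t) (ψ t)) ∧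
      ∀ x, curl2 (Uω (h t) (v t) (ψ t)) x
        = √(1 + ‖∇ (h t) x‖ ^ 2) * normalVorticity (h t) (v t) x) ∧
    (∀ t ∈ Icc 0 T, (∀ x, normalVorticity (h t) (v t) x = 0) →
      ∃ α : E2 → ℝ, ∀ x, HasGradientAt α (Uω (h t) (v t) (ψ t) x) x) ∧
    (∀ t ∈ Icc 0 T, ∀ x,
      HasDerivWithinAt (fun s => h s x) (dirichletNeumann (h t) (φ t) x) (Icc 0 T) t) ∧
    ((∀ t ∈ Icc 0 T, ∀ x, normalVorticity (h t) (v t) x = 0) →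
      ∀ α : ℝ → E2 → ℝ,
        (∀ t ∈ Icc 0 T, ∀ x, HasGradientAt (α t) (Uω (h t) (v t) (ψ t) x) x) →
        ∃ c : ℝ → ℝ, ∃ a : ℝ → E2 → ℝ, (∀ t x, a t x = α t x + c t) ∧
          (∀ t ∈ Icc 0 T, ∀ x, HasGradientAt (a t) (Uω (h t) (v t) (ψ t) x) x) ∧
          ∀ t ∈ Icc 0 T, ∀ x,
            HasDerivWithinAt (fun s => φ s x + a s x)
              (zakharovRHS (h t) (φ t) x + Rω (h t) (φ t) (Vω (h t) (v t) (ψ t)) x)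
              (Icc 0 T) t) := by
  obtain rfl : φ = fun t => trace (h t) (ψ t) := funext hφ
  refine ⟨fun t ht => hflow.curl2_Uω ht (hψ t ht).1, fun t ht hω => ?_, fun t ht x =>
    hflow.hasDerivWithinAt_dirichletNeumann hT ht (hψ t ht) x, fun hω α hα => ?_⟩
  · obtain ⟨hd, hc⟩ := hflow.curl2_Uω ht (hψ t ht).1
    exact exists_hasGradientAt_of_curl2_eq_zero hd fun x => by rw [hc, hω, mul_zero]
  · obtain ⟨f, hf⟩ := hflow.exists_potential hT hω
    have hηd : ∀ t ∈ Icc 0 T, Differentiable ℝ (h t) := fun t ht =>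
      (hflow.contDiff_slice ht).differentiable (by norm_num)
    -- At each time `φ + α` and `f` both have the tangential trace of `v` as gradient, so their
    -- difference does not depend on `x`.
    have hconst : ∀ t ∈ Icc 0 T, ∀ x, trace (h t) (ψ t) x + α t x - f (t, x) =
        trace (h t) (ψ t) 0 + α t 0 - f (t, 0) := by
      intro t ht x
      have hd : ∀ y, HasFDerivAt (fun y => trace (h t) (ψ t) y + α t y - f (t, y))
          (0 : E2 →L[ℝ] ℝ) y := by
        intro y
        have h1 := (hasGradientAt_trace (hηd t ht)
          ((hψ t ht).1.contDiff.differentiableOn (by norm_num) _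
            (surfacePoint_mem_fluid (h t) y))).hasFDerivAt
        convert! (h1.fun_add (hα t ht y).hasFDerivAt).fun_sub (hf t ht y).1.hasFDerivAt using 1
        rw [← map_add, ← map_sub, Uω_eq_tangentialTrace, tangentialTrace_rotational, sub_self,
          map_zero]
      exact is_const_of_fderiv_eq_zero (𝕜 := ℝ) (fun y => (hd y).differentiableAt)
        (fun y => (hd y).fderiv) x 0
    -- With this correction `φ + a` equals `f` on the strip and inherits its time derivative,
    -- although neither `φ` nor `α` is known to be differentiable in time.
    set c : ℝ → ℝ := fun t => -(trace (h t) (ψ t) 0 + α t 0 - f (t, 0)) with hc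
    refine ⟨c, fun t x => α t x + c t, fun t x => rfl, fun t ht x => ?_, fun t ht x => ?_⟩
    · exact hasGradientAt_iff_hasFDerivAt.2
        ((hα t ht x).hasFDerivAt.add_const (c t))
    · rw [zakharovRHS_add_Rω (hηd t ht) (hψ t ht)]
      have heq : ∀ s ∈ Icc 0 T, trace (h s) (ψ s) x + (α s x + c s) = f (s, x) := fun s hs => by
        have := hconst s hs x
        simp only [hc]
        linarith
      exact (hf t ht x).2.congr heq (heq t ht)
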